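/- Let $k$ be an algebraically closed field of characteristic $0$. **Algebras.** A *Hom-super vector space* is a $\mathbb Z/2$-graded vector space $V=V_0\oplus V_1$ with linear maps $\alpha_V:V_0\to V_0$, $\beta_V:V_1\to V_1$ (we write $\alpha,\beta$). A (multiplicative) *Hom-Lie antialgebra* is a Hom-super vector space $\mathfrak a$ with bilinear products: a commutative $x_1x_2\in\mathfrak a_0$, a product $xy\in\mathfrak a_1$ and a skew-symmetric $[y_1,y_2]\in\mathfrak a_0$ ($x,x_i\in\mathfrak a_0$; $y,y_i\in\mathfrak a_1$) such that $(\alpha,\beta)$ is multiplicative for the three products and $$\alpha(x_1)(x_2x_3)=(x_1x_2)\alpha(x_3),\quad \alpha(x_1)(x_2y)=\tfrac12(x_1x_2)\beta(y),$$ $$\alpha(x)[y_1,y_2]=[xy_1,\beta(y_2)]+[\beta(y_1),xy_2],\quad [y_2,y_3]\beta(y_1)+[y_3,y_1]\beta(y_2)+[y_1,y_2]\beta(y_3)=0 .$$ Homomorphisms are even linear maps commuting with $\alpha,\beta$ and with the products. **Representations.** A *representation* $\rho=(\rho_0,\rho_1)$ of $\mathfrak a$ over a Hom-super vector space $V$ consists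 of bilinear maps $\rho_0(x):V_0\to V_0,\ V_1\to V_1$ and $\rho_1(y):V_0\to V_1,\ V_1\to V_0$ ($x\in\mathfrak a_0$, $y\in\mathfrak a_1$) with, for $u\in V_0$, $w\in V_1$: the structure maps of $V$ satisfy $\alpha_V(\rho_0(x)u)=\rho_0(\alpha x)\alpha_Vu$, $\beta_V(\rho_0(x)w)=\rho_0(\alpha x)\beta_Vw$, $\beta_V(\rho_1(y)u)=\rho_1(\beta y)\alpha_Vu$, $\alpha_V(\rho_1(y)w)=\rho_1(\beta y)\beta_Vw$, and $$\rho_0(\alpha x_1)\rho_0(x_2)u=\rho_0(x_1x_2)\alpha_Vu,\qquad \rho_0(\alpha x_1)\rho_0(x_2)w=\tfrac12\rho_0(x_1x_2)\beta_Vw,$$ $$\rho_0(\alpha x)\rho_1(y)u=\tfrac12\rho_1(\beta y)\rho_0(x)u=\rho_1(xy)\alpha_Vu,\qquad \rho_0(\alpha x)\rho_1(y)w=\rho_1(xy)\beta_Vw+\rho_1(\beta y)\rho_0(x)w,$$ $$\rho_0([y_1,y_2])\alpha_Vu=\rho_1(\beta y_1)\rho_1(y_2)u-\rho_1(\beta y_2)\rho_1(y_1)u,$$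 $$\rho_0([y_1,y_2])\beta_Vw=-\rho_1(\beta y_1)\rho_1(y_2)w+\rho_1(\beta y_2)\rho_1(y_1)w .$$ An *action* of $\mathfrak a$ over a Hom-Lie antialgebra $V$ is a representation over its Hom-super vector space with, for $u,u_i\in V_0$, $w,w_i\in V_1$, $$\rho_0(\alpha x)(u_1u_2)=(\rho_0(x)u_1)\alpha(u_2),\quad \rho_0(\alpha x)(uw)=\tfrac12(\rho_0(x)u)\beta(w)=\alpha(u)(\rho_0(x)w),$$ $$\alpha(u_1)(\rho_1(y)u_2)=\tfrac12\rho_1(\beta y)(u_1u_2),\quad \rho_0(\alpha x)[w_1,w_2]=[\rho_0(x)w_1,\beta w_2]+[\beta w_1,\rho_0(x)w_2],$$ $$\rho_1(\beta y)(uw)=\alpha(u)(\rho_1(y)w)-[\rho_1(y)u,\beta w],\quad \rho_1(\beta y)[w_1,w_2]=(\rho_1(y)w_2)\beta(w_1)-(\rho_1(y)w_1)\beta(w_2).$$ **Crossed module extensions.** A *crossed module* is a homomorphism $d:V\to\mathfrak a$ with an action of $\mathfrak a$ over $V$ such that $d(\rho_0(x)u)=x\,d(u)$, $d(\rho_0(x)w)=x\,d(w)$,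 $d(\rho_1(y)u)=d(u)\,y$, $d(\rho_1(y)w)=[y,d(w)]$ and $\rho_0(du_1)u_2=u_1u_2$, $\rho_1(dw_1)w_2=[w_1,w_2]$, $\rho_0(du)w=uw=\rho_1(dw)u$. Let $\mathfrak g$ be a Hom-Lie antialgebra and $(M,\rho)$ a representation of it. Give $M$ the zero product. A *crossed module extension* of $\mathfrak g$ by $M$ is an exact sequence of Hom-Lie antialgebras $$0\to M\xrightarrow{i}V\xrightarrow{d}\mathfrak a\xrightarrow{p}\mathfrak g\to0$$ in which $d$ is a crossed module and the action of $\mathfrak a$ on $V$ induces the given representation of $\mathfrak g$ on $M$. *Sections* of it are linear maps $s=(s_0,s_1):\mathfrak g\to\mathfrak a$, $\sigma=(\sigma_0,\sigma_1):\operatorname{Ker}p=\operatorname{Im}d\to V$, even and commuting with the structure maps $\alpha,\beta$, with $ps=\mathrm{id}$ and $d\sigma=\mathrm{id}$. We consider the extensions that have sections, i.e. that split as sequences of Hom-super vector spaces. A morphism of extensions is a pair of homomorphisms $\varphi:V\to V'$, $\psi:\mathfrak a\to\mathfrak a'$ compatible with the actions and with the maps $i,d,p$, inducing the identity on $M$ and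 on $\mathfrak g$. Let $\mathbf{CExt}(\mathfrak g,M)$ be the set of classes for the equivalence relation generated by the existence of a morphism. **Cohomology.** Let $a,a_i\in\mathfrak g_0$, $b,b_i\in\mathfrak g_1$. A *2-cochain* is a triple of bilinear maps $\omega_0:\mathfrak g_0\times\mathfrak g_0\to M_0$ (symmetric), $\omega_1:\mathfrak g_0\times\mathfrak g_1\to M_1$, $\omega_2:\mathfrak g_1\times\mathfrak g_1\to M_0$ (skew-symmetric), commuting with the structure maps. Its coboundary $d\omega=(h_0,h_1,h_2,h_3)$ is $$\begin{aligned} h_0(a_1,a_2,a_3)&=\rho_0(\alpha a_1)\omega_0(a_2,a_3)+\omega_0(\alpha a_1,a_2a_3)-\rho_0(\alpha a_3)\omega_0(a_1,a_2)-\omega_0(a_1a_2,\alpha a_3),\\ h_1(a_1,a_2,b)&=\rho_0(\alpha a_1)\omega_1(a_2,b)+\omega_1(\alpha a_1,a_2b)-\tfrac12\rho_1(\beta b)\omega_0(a_1,a_2)-\tfrac12\omega_1(a_1a_2,\beta b),\\ h_2(a,b_1,b_2)&=\rho_0(\alpha a)\omega_2(b_1,b_2)+\omega_0(\alpha a,[b_1,b_2])+\rho_1(\beta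 b_2)\omega_1(a,b_1)-\omega_2(ab_1,\beta b_2)\\&\quad-\rho_1(\beta b_1)\omega_1(a,b_2)-\omega_2(\beta b_1,ab_2),\\ h_3(b_1,b_2,b_3)&=\sum_{\mathrm{cyc}(1,2,3)}\bigl(\rho_1(\beta b_1)\omega_2(b_2,b_3)+\omega_1([b_2,b_3],\beta b_1)\bigr). \end{aligned}\tag{$*$}$$ A *3-cochain* is a quadruple of trilinear maps $h_0:\mathfrak g_0^3\to M_0$, $h_1:\mathfrak g_0^2\times\mathfrak g_1\to M_1$, $h_2:\mathfrak g_0\times\mathfrak g_1^2\to M_0$, $h_3:\mathfrak g_1^3\to M_1$, commuting with the structure maps, skew-symmetric in the odd arguments, with $h_0(a_1,a_2,a_3)-h_0(a_2,a_1,a_3)+h_0(a_2,a_3,a_1)=0$. It is a *3-cocycle* if $$\begin{aligned} 0&=\rho_0(\alpha^2a_1)h_0(a_2,a_3,a_4)-h_0(a_1a_2,\alpha a_3,\alpha a_4)+h_0(\alpha a_1,a_2a_3,\alpha a_4)-h_0(\alpha a_1,\alpha a_2,a_3a_4)\\&\quad+\rho_0(\alpha^2a_4)h_0(a_1,a_2,a_3),\\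 0&=\rho_0(\alpha^2a_1)h_1(a_2,a_3,b)-h_1(\alpha a_1,\alpha a_2,a_3b)+\tfrac12h_1(\alpha a_1,a_2a_3,\beta b)-\tfrac12h_1(a_1a_2,\alpha a_3,\beta b)\\&\quad+\tfrac14\rho_1(\beta^2b)h_0(a_1,a_2,a_3),\\ 0&=\Gamma(a_1,a_2)-\Gamma(a_2,a_1),\qquad\text{where}\\ \Gamma(a_1,a_2)&=\rho_0(\alpha^2a_1)h_2(a_2,b_1,b_2)+h_2(\alpha a_1,a_2b_1,\beta b_2)+h_2(\alpha a_1,\beta b_1,a_2b_2)-\rho_1(\beta^2b_2)h_1(a_1,a_2,b_1)\\&\quad+\rho_1(\beta^2b_1)h_1(a_1,a_2,b_2)-h_0(\alpha a_1,\alpha a_2,[b_1,b_2]),\\ 0&=\sum_{\mathrm{cyc}(1,2,3)}\bigl(h_3(ab_1,\beta b_2,\beta b_3)+\rho_1(\beta^2b_1)h_2(a,b_2,b_3)-h_1([b_2,b_3],\alpha a,\beta b_1)+3h_1(\alpha a,[b_2,b_3],\beta b_1)\bigr)\\&\quad-3\rho_0(\alpha^2a)h_3(b_1,b_2,b_3).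 \end{aligned}$$ The coboundaries $d\omega$ of 2-cochains are 3-cocycles, and $H^3(\mathfrak g,M)$ is the quotient of the space of 3-cocycles by them. **Theorem.** For a crossed module extension of $\mathfrak g$ by $M$ with sections $s,\sigma$, put $$\omega_0(a_1,a_2)=\sigma_0\bigl(s_0(a_1)s_0(a_2)-s_0(a_1a_2)\bigr),\quad \omega_1(a,b)=\sigma_1\bigl(s_0(a)s_1(b)-s_1(ab)\bigr),$$ $$\omega_2(b_1,b_2)=\sigma_0\bigl([s_1(b_1),s_1(b_2)]-s_0([b_1,b_2])\bigr),$$ and let $h=(h_0,h_1,h_2,h_3)$ be given by the formulas $(*)$, where $\rho_0(\cdot),\rho_1(\cdot)$ now stand for the action of $\mathfrak a$ on $V$ at $s_0(\cdot)$, $s_1(\cdot)$: for instance $\rho_0(\alpha a_1)\omega_0(a_2,a_3)$ means $\rho_0(s_0(\alpha a_1))\,\omega_0(a_2,a_3)$. Then $h$ takes its values in $M$ and is a 3-cocycle, and its class in $H^3(\mathfrak g,M)$ depends neither on the sections $s,\sigma$ nor on the representative of the equivalence class of the extension. That is, there is exactly one map $$\xi:\mathbf{CExt}(\mathfrak g,M)\to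 H^3(\mathfrak g,M)$$ that sends the class of every such extension to $[h]$, for every choice of the sections $s,\sigma$. -/

import Mathlib

set_option maxSynthPendingDepth 3

universe v u₁ u₂ w

/-- A Hom-super vector space: a `ℤ/2`-graded vector space `Even ⊕ Odd` with an even linear self-map,
given by its two components `α` and `β`. -/
structure HomSuperSpace (k : Type v) [Field k] where
  Even : Type w
  Odd : Type w
  [evenGroup : AddCommGroup Even]
  [oddGroup : AddCommGroup Odd]
  [evenModule : Module k Even]
  [oddModule : Module k Odd]
  α : Even →ₗ[k] Even
  β : Odd →ₗ[k] Odd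

attribute [instance] HomSuperSpace.evenGroup HomSuperSpace.oddGroup
  HomSuperSpace.evenModule HomSuperSpace.oddModule

/-- A (multiplicative) Hom-Lie antialgebra. The supercommutative product is given by its components
`mul` (even times even), `act` (even times odd, which is also odd times even) and
`bracket` (odd times odd, skew-symmetric). -/
structure HomLieAntialgebra (k : Type v) [Field k] extends HomSuperSpace.{v, w} k where
  mul : Even →ₗ[k] Even →ₗ[k] Even
  act : Even →ₗ[k] Odd →ₗ[k] Odd
  bracket : Odd →ₗ[k] Odd →ₗ[k] Even
  mul_comm : ∀ x₁ x₂, mul x₁ x₂ = mul x₂ x₁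
  bracket_skew : ∀ y₁ y₂, bracket y₁ y₂ = -bracket y₂ y₁
  hom_assoc : ∀ x₁ x₂ x₃, mul (α x₁) (mul x₂ x₃) = mul (mul x₁ x₂) (α x₃)
  hom_act : ∀ x₁ x₂ y, act (α x₁) (act x₂ y) = (2⁻¹ : k) • act (mul x₁ x₂) (β y)
  hom_deriv : ∀ x y₁ y₂,
    mul (α x) (bracket y₁ y₂) = bracket (act x y₁) (β y₂) + bracket (β y₁) (act x y₂)
  hom_jacobi : ∀ y₁ y₂ y₃,
    act (bracket y₂ y₃) (β y₁) + act (bracket y₃ y₁) (β y₂) + act (bracket y₁ y₂) (β y₃) = 0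
  α_mul : ∀ x₁ x₂, α (mul x₁ x₂) = mul (α x₁) (α x₂)
  β_act : ∀ x y, β (act x y) = act (α x) (β y)
  α_bracket : ∀ y₁ y₂, α (bracket y₁ y₂) = bracket (β y₁) (β y₂)

/-- A homomorphism of Hom-Lie antialgebras. -/
structure HomLieAntialgebra.Hom {k : Type v} [Field k]
    (A : HomLieAntialgebra.{v, u₁} k) (B : HomLieAntialgebra.{v, u₂} k) where
  even : A.Even →ₗ[k] B.Even
  odd : A.Odd →ₗ[k] B.Odd
  map_α : ∀ x, even (A.α x) = B.α (even x)
  map_β : ∀ y, odd (A.β y) = B.β (odd y)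
  map_mul : ∀ x₁ x₂, even (A.mul x₁ x₂) = B.mul (even x₁) (even x₂)
  map_act : ∀ x y, odd (A.act x y) = B.act (even x) (odd y)
  map_bracket : ∀ y₁ y₂, even (A.bracket y₁ y₂) = B.bracket (odd y₁) (odd y₂)

/-- A Hom-super vector space, regarded as a Hom-Lie antialgebra with zero product. The maps `α` and
`β` are automatically multiplicative. -/
abbrev HomSuperSpace.trivialAlgebra {k : Type v} [Field k] (M : HomSuperSpace.{v, u₁} k) :
    HomLieAntialgebra.{v, u₁} k where
  toHomSuperSpace := M
  mul := 0
  act := 0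
  bracket := 0
  mul_comm := by simp
  bracket_skew := by simp
  hom_assoc := by simp
  hom_act := by simp
  hom_deriv := by simp
  hom_jacobi := by simp
  α_mul := by simp
  β_act := by simp
  α_bracket := by simp

/-- A representation of the Hom-Lie antialgebra `A` over the Hom-super vector space `V`. The even map
`ρ₀ : A₀ → End(V)₀` has the components `ρ₀₀`, `ρ₀₁` (on `V₀` and on `V₁`), and
`ρ₁ : A₁ → End(V)₁` has the components `ρ₁₀ : A₁ → Hom(V₀, V₁)` and `ρ₁₁ : A₁ → Hom(V₁, V₀)`. -/
structure HomLieRep {k : Type v} [Field k]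
    (A : HomLieAntialgebra.{v, u₁} k) (V : HomSuperSpace.{v, u₂} k) where
  ρ₀₀ : A.Even →ₗ[k] V.Even →ₗ[k] V.Even
  ρ₀₁ : A.Even →ₗ[k] V.Odd →ₗ[k] V.Odd
  ρ₁₀ : A.Odd →ₗ[k] V.Even →ₗ[k] V.Odd
  ρ₁₁ : A.Odd →ₗ[k] V.Odd →ₗ[k] V.Even
  α_ρ₀₀ : ∀ x u, V.α (ρ₀₀ x u) = ρ₀₀ (A.α x) (V.α u)
  β_ρ₀₁ : ∀ x w, V.β (ρ₀₁ x w) = ρ₀₁ (A.α x) (V.β w)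
  β_ρ₁₀ : ∀ y u, V.β (ρ₁₀ y u) = ρ₁₀ (A.β y) (V.α u)
  α_ρ₁₁ : ∀ y w, V.α (ρ₁₁ y w) = ρ₁₁ (A.β y) (V.β w)
  even_even_even : ∀ x₁ x₂ u, ρ₀₀ (A.α x₁) (ρ₀₀ x₂ u) = ρ₀₀ (A.mul x₁ x₂) (V.α u)
  even_even_odd : ∀ x₁ x₂ w,
    ρ₀₁ (A.α x₁) (ρ₀₁ x₂ w) = (2⁻¹ : k) • ρ₀₁ (A.mul x₁ x₂) (V.β w)
  even_odd_even : ∀ x y u, ρ₀₁ (A.α x) (ρ₁₀ y u) = (2⁻¹ : k) • ρ₁₀ (A.β y) (ρ₀₀ x u)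
  act_even : ∀ x y u, ρ₁₀ (A.act x y) (V.α u) = (2⁻¹ : k) • ρ₁₀ (A.β y) (ρ₀₀ x u)
  even_odd_odd : ∀ x y w,
    ρ₀₀ (A.α x) (ρ₁₁ y w) = ρ₁₁ (A.act x y) (V.β w) + ρ₁₁ (A.β y) (ρ₀₁ x w)
  bracket_even : ∀ y₁ y₂ u,
    ρ₀₀ (A.bracket y₁ y₂) (V.α u) = ρ₁₁ (A.β y₁) (ρ₁₀ y₂ u) - ρ₁₁ (A.β y₂) (ρ₁₀ y₁ u)
  bracket_odd : ∀ y₁ y₂ w,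
    ρ₀₁ (A.bracket y₁ y₂) (V.β w) = -ρ₁₀ (A.β y₁) (ρ₁₁ y₂ w) + ρ₁₀ (A.β y₂) (ρ₁₁ y₁ w)

/-- An action of the Hom-Lie antialgebra `A` over the Hom-Lie antialgebra `V`: a representation on
the underlying Hom-super vector space that is compatible with the product of `V`. -/
structure HomLieAction {k : Type v} [Field k]
    (A : HomLieAntialgebra.{v, u₁} k) (V : HomLieAntialgebra.{v, u₂} k) extends
    HomLieRep A V.toHomSuperSpace where
  even_mul : ∀ x u₁ u₂, ρ₀₀ (A.α x) (V.mul u₁ u₂) = V.mul (ρ₀₀ x u₁) (V.α u₂)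
  even_act : ∀ x u w, ρ₀₁ (A.α x) (V.act u w) = (2⁻¹ : k) • V.act (ρ₀₀ x u) (V.β w)
  odd_mul : ∀ y u₁ u₂,
    V.act (V.α u₁) (ρ₁₀ y u₂) = (2⁻¹ : k) • ρ₁₀ (A.β y) (V.mul u₁ u₂)
  even_act' : ∀ x u w, V.act (V.α u) (ρ₀₁ x w) = (2⁻¹ : k) • V.act (ρ₀₀ x u) (V.β w)
  even_bracket : ∀ x w₁ w₂,
    ρ₀₀ (A.α x) (V.bracket w₁ w₂) =
      V.bracket (ρ₀₁ x w₁) (V.β w₂) + V.bracket (V.β w₁) (ρ₀₁ x w₂)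
  odd_act : ∀ y u w,
    ρ₁₁ (A.β y) (V.act u w) = V.mul (V.α u) (ρ₁₁ y w) - V.bracket (ρ₁₀ y u) (V.β w)
  odd_bracket : ∀ y w₁ w₂,
    ρ₁₀ (A.β y) (V.bracket w₁ w₂) =
      V.act (ρ₁₁ y w₂) (V.β w₁) - V.act (ρ₁₁ y w₁) (V.β w₂)

/-- The homomorphism `d : V → A`, together with the action `ρ` of `A` over `V`, is a crossed module
of Hom-Lie antialgebras. -/
structure IsCrossedModule {k : Type v} [Field k]
    {A : HomLieAntialgebra.{v, u₁} k} {V : HomLieAntialgebra.{v, u₂} k}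
    (ρ : HomLieAction A V) (d : V.Hom A) : Prop where
  d_ρ₀₀ : ∀ x u, d.even (ρ.ρ₀₀ x u) = A.mul x (d.even u)
  d_ρ₀₁ : ∀ x w, d.odd (ρ.ρ₀₁ x w) = A.act x (d.odd w)
  d_ρ₁₀ : ∀ y u, d.odd (ρ.ρ₁₀ y u) = A.act (d.even u) y
  d_ρ₁₁ : ∀ y w, d.even (ρ.ρ₁₁ y w) = A.bracket y (d.odd w)
  peiffer_mul : ∀ u₁ u₂, ρ.ρ₀₀ (d.even u₁) u₂ = V.mul u₁ u₂
  peiffer_bracket : ∀ w₁ w₂, ρ.ρ₁₁ (d.odd w₁) w₂ = V.bracket w₁ w₂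
  peiffer_act : ∀ u w, ρ.ρ₀₁ (d.even u) w = V.act u w
  peiffer_act' : ∀ u w, ρ.ρ₁₀ (d.odd w) u = V.act u w

/-! ### Cohomology in degree three -/

section Cohomology

variable {k : Type v} [Field k] {G : HomLieAntialgebra.{v, u₁} k} {M : HomSuperSpace.{v, u₂} k}

/-- Triples `ω = (ω₀, ω₁, ω₂)` of bilinear maps `G₀ × G₀ → M₀`, `G₀ × G₁ → M₁`, `G₁ × G₁ → M₀`. -/
abbrev BilinearTriple (G : HomLieAntialgebra.{v, u₁} k) (M : HomSuperSpace.{v, u₂} k) :=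
  (G.Even →ₗ[k] G.Even →ₗ[k] M.Even) × (G.Even →ₗ[k] G.Odd →ₗ[k] M.Odd) ×
    (G.Odd →ₗ[k] G.Odd →ₗ[k] M.Even)

/-- Quadruples `h = (h₀, h₁, h₂, h₃)` of trilinear maps `G₀ × G₀ × G₀ → M₀`, `G₀ × G₀ × G₁ → M₁`,
`G₀ × G₁ × G₁ → M₀`, `G₁ × G₁ × G₁ → M₁`. -/
abbrev TrilinearQuadruple (G : HomLieAntialgebra.{v, u₁} k) (M : HomSuperSpace.{v, u₂} k) :=
  (G.Even →ₗ[k] G.Even →ₗ[k] G.Even →ₗ[k] M.Even) ×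
    (G.Even →ₗ[k] G.Even →ₗ[k] G.Odd →ₗ[k] M.Odd) ×
    (G.Even →ₗ[k] G.Odd →ₗ[k] G.Odd →ₗ[k] M.Even) ×
    (G.Odd →ₗ[k] G.Odd →ₗ[k] G.Odd →ₗ[k] M.Odd)

/-- `ω` is a `2`-cochain: it has the symmetry of a supercommutative product and commutes with the
structure maps. -/
structure IsCochain₂ (ω : BilinearTriple G M) : Prop where
  symm₀ : ∀ a₁ a₂, ω.1 a₁ a₂ = ω.1 a₂ a₁
  skew₂ : ∀ b₁ b₂, ω.2.2 b₁ b₂ = -ω.2.2 b₂ b₁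
  equivariant₀ : ∀ a₁ a₂, M.α (ω.1 a₁ a₂) = ω.1 (G.α a₁) (G.α a₂)
  equivariant₁ : ∀ a b, M.β (ω.2.1 a b) = ω.2.1 (G.α a) (G.β b)
  equivariant₂ : ∀ b₁ b₂, M.α (ω.2.2 b₁ b₂) = ω.2.2 (G.β b₁) (G.β b₂)

/-- `h` is a `3`-cochain: it is skew-symmetric in the odd arguments, `h₀` vanishes on shuffles (the
symmetry of the associator of a commutative product, as for Harrison cochains), and `h` commutes with
the structure maps. -/
structure IsCochain₃ (h : TrilinearQuadruple G M) : Prop where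
  shuffle₀ : ∀ a₁ a₂ a₃, h.1 a₁ a₂ a₃ - h.1 a₂ a₁ a₃ + h.1 a₂ a₃ a₁ = 0
  skew₂ : ∀ a b₁ b₂, h.2.2.1 a b₁ b₂ = -h.2.2.1 a b₂ b₁
  skew₃ : ∀ b₁ b₂ b₃, h.2.2.2 b₁ b₂ b₃ = -h.2.2.2 b₂ b₁ b₃
  skew₃' : ∀ b₁ b₂ b₃, h.2.2.2 b₁ b₂ b₃ = -h.2.2.2 b₁ b₃ b₂
  equivariant₀ : ∀ a₁ a₂ a₃, M.α (h.1 a₁ a₂ a₃) = h.1 (G.α a₁) (G.α a₂) (G.α a₃)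
  equivariant₁ : ∀ a₁ a₂ b, M.β (h.2.1 a₁ a₂ b) = h.2.1 (G.α a₁) (G.α a₂) (G.β b)
  equivariant₂ : ∀ a b₁ b₂, M.α (h.2.2.1 a b₁ b₂) = h.2.2.1 (G.α a) (G.β b₁) (G.β b₂)
  equivariant₃ : ∀ b₁ b₂ b₃, M.β (h.2.2.2 b₁ b₂ b₃) = h.2.2.2 (G.β b₁) (G.β b₂) (G.β b₃)

/-- `h = dω`: the coboundary of a `2`-cochain, the linearization of the four defining identities of a
Hom-Lie antialgebra. -/
structure IsCoboundaryOf (ρ : HomLieRep G M) (h : TrilinearQuadruple G M)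
    (ω : BilinearTriple G M) : Prop where
  d₀ : ∀ a₁ a₂ a₃, h.1 a₁ a₂ a₃ =
    ρ.ρ₀₀ (G.α a₁) (ω.1 a₂ a₃) + ω.1 (G.α a₁) (G.mul a₂ a₃)
      - ρ.ρ₀₀ (G.α a₃) (ω.1 a₁ a₂) - ω.1 (G.mul a₁ a₂) (G.α a₃)
  d₁ : ∀ a₁ a₂ b, h.2.1 a₁ a₂ b =
    ρ.ρ₀₁ (G.α a₁) (ω.2.1 a₂ b) + ω.2.1 (G.α a₁) (G.act a₂ b)
      - (2⁻¹ : k) • ρ.ρ₁₀ (G.β b) (ω.1 a₁ a₂) - (2⁻¹ : k) • ω.2.1 (G.mul a₁ a₂) (G.β b)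
  d₂ : ∀ a b₁ b₂, h.2.2.1 a b₁ b₂ =
    ρ.ρ₀₀ (G.α a) (ω.2.2 b₁ b₂) + ω.1 (G.α a) (G.bracket b₁ b₂)
      + ρ.ρ₁₁ (G.β b₂) (ω.2.1 a b₁) - ω.2.2 (G.act a b₁) (G.β b₂)
      - ρ.ρ₁₁ (G.β b₁) (ω.2.1 a b₂) - ω.2.2 (G.β b₁) (G.act a b₂)
  d₃ : ∀ b₁ b₂ b₃, h.2.2.2 b₁ b₂ b₃ =
    ρ.ρ₁₀ (G.β b₁) (ω.2.2 b₂ b₃) + ω.2.1 (G.bracket b₂ b₃) (G.β b₁)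
      + ρ.ρ₁₀ (G.β b₂) (ω.2.2 b₃ b₁) + ω.2.1 (G.bracket b₃ b₁) (G.β b₂)
      + ρ.ρ₁₀ (G.β b₃) (ω.2.2 b₁ b₂) + ω.2.1 (G.bracket b₁ b₂) (G.β b₃)

/-- `dh = 0`. The components of `dh` have `0`, `1`, `2`, `3` odd arguments; they linearize all the
identities that hold between the four defining identities of a Hom-Lie antialgebra in four
arguments. There is no such identity in four odd arguments. -/
structure IsClosed₃ (ρ : HomLieRep G M) (h : TrilinearQuadruple G M) : Prop where
  closed₀ : ∀ a₁ a₂ a₃ a₄,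
    ρ.ρ₀₀ (G.α (G.α a₁)) (h.1 a₂ a₃ a₄) - h.1 (G.mul a₁ a₂) (G.α a₃) (G.α a₄)
      + h.1 (G.α a₁) (G.mul a₂ a₃) (G.α a₄) - h.1 (G.α a₁) (G.α a₂) (G.mul a₃ a₄)
      + ρ.ρ₀₀ (G.α (G.α a₄)) (h.1 a₁ a₂ a₃) = 0
  closed₁ : ∀ a₁ a₂ a₃ b,
    ρ.ρ₀₁ (G.α (G.α a₁)) (h.2.1 a₂ a₃ b) - h.2.1 (G.α a₁) (G.α a₂) (G.act a₃ b)
      + (2⁻¹ : k) • h.2.1 (G.α a₁) (G.mul a₂ a₃) (G.β b)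
      - (2⁻¹ : k) • h.2.1 (G.mul a₁ a₂) (G.α a₃) (G.β b)
      + (4⁻¹ : k) • ρ.ρ₁₀ (G.β (G.β b)) (h.1 a₁ a₂ a₃) = 0
  closed₂ : ∀ a₁ a₂ b₁ b₂,
    (ρ.ρ₀₀ (G.α (G.α a₁)) (h.2.2.1 a₂ b₁ b₂) + h.2.2.1 (G.α a₁) (G.act a₂ b₁) (G.β b₂)
      + h.2.2.1 (G.α a₁) (G.β b₁) (G.act a₂ b₂) - ρ.ρ₁₁ (G.β (G.β b₂)) (h.2.1 a₁ a₂ b₁)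
      + ρ.ρ₁₁ (G.β (G.β b₁)) (h.2.1 a₁ a₂ b₂) - h.1 (G.α a₁) (G.α a₂) (G.bracket b₁ b₂)) -
    (ρ.ρ₀₀ (G.α (G.α a₂)) (h.2.2.1 a₁ b₁ b₂) + h.2.2.1 (G.α a₂) (G.act a₁ b₁) (G.β b₂)
      + h.2.2.1 (G.α a₂) (G.β b₁) (G.act a₁ b₂) - ρ.ρ₁₁ (G.β (G.β b₂)) (h.2.1 a₂ a₁ b₁)
      + ρ.ρ₁₁ (G.β (G.β b₁)) (h.2.1 a₂ a₁ b₂) - h.1 (G.α a₂) (G.α a₁) (G.bracket b₁ b₂)) = 0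
  closed₃ : ∀ a b₁ b₂ b₃,
    (h.2.2.2 (G.act a b₁) (G.β b₂) (G.β b₃) + ρ.ρ₁₀ (G.β (G.β b₁)) (h.2.2.1 a b₂ b₃)
      - h.2.1 (G.bracket b₂ b₃) (G.α a) (G.β b₁)
      + (3 : k) • h.2.1 (G.α a) (G.bracket b₂ b₃) (G.β b₁)) +
    (h.2.2.2 (G.act a b₂) (G.β b₃) (G.β b₁) + ρ.ρ₁₀ (G.β (G.β b₂)) (h.2.2.1 a b₃ b₁)
      - h.2.1 (G.bracket b₃ b₁) (G.α a) (G.β b₂)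
      + (3 : k) • h.2.1 (G.α a) (G.bracket b₃ b₁) (G.β b₂)) +
    (h.2.2.2 (G.act a b₃) (G.β b₁) (G.β b₂) + ρ.ρ₁₀ (G.β (G.β b₃)) (h.2.2.1 a b₁ b₂)
      - h.2.1 (G.bracket b₁ b₂) (G.α a) (G.β b₃)
      + (3 : k) • h.2.1 (G.α a) (G.bracket b₁ b₂) (G.β b₃)) -
    (3 : k) • ρ.ρ₀₁ (G.α (G.α a)) (h.2.2.2 b₁ b₂ b₃) = 0

theorem IsCochain₂.zero : IsCochain₂ (0 : BilinearTriple G M) := by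
  constructor <;> simp

theorem IsCochain₂.add {ω ω' : BilinearTriple G M} (h : IsCochain₂ ω) (h' : IsCochain₂ ω') :
    IsCochain₂ (ω + ω') := by
  obtain ⟨p₁, p₂, p₃, p₄, p₅⟩ := h
  obtain ⟨q₁, q₂, q₃, q₄, q₅⟩ := h'
  constructor
  · intro x y
    exact congrArg₂ (· + ·) (p₁ x y) (q₁ x y)
  · intro x y
    refine (congrArg₂ (· + ·) (p₂ x y) (q₂ x y)).trans ?_
    simp; abel
  all_goals simp [p₃, p₄, p₅, q₃, q₄, q₅]

theorem IsCochain₂.smul (c : k) {ω : BilinearTriple G M} (h : IsCochain₂ ω) :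
    IsCochain₂ (c • ω) := by
  obtain ⟨p₁, p₂, p₃, p₄, p₅⟩ := h
  constructor
  · intro x y
    exact congrArg (c • ·) (p₁ x y)
  · intro x y
    refine (congrArg (c • ·) (p₂ x y)).trans ?_
    simp
  all_goals simp [p₃, p₄, p₅]

/-- The space `Z³(G, M)` of `3`-cocycles. -/
def cocycles₃ (ρ : HomLieRep G M) : Submodule k (TrilinearQuadruple G M) where
  carrier := {h | IsCochain₃ h ∧ IsClosed₃ ρ h}
  zero_mem' := by
    refine ⟨?_, ?_⟩ <;> constructor <;> simp
  add_mem' := by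
    rintro h h' ⟨⟨p₁, p₂, p₃, p₄, p₅, p₆, p₇, p₈⟩, ⟨c₁, c₂, c₃, c₄⟩⟩
      ⟨⟨q₁, q₂, q₃, q₄, q₅, q₆, q₇, q₈⟩, ⟨e₁, e₂, e₃, e₄⟩⟩
    refine ⟨⟨?_, ?_, ?_, ?_, ?_, ?_, ?_, ?_⟩, ⟨?_, ?_, ?_, ?_⟩⟩
    · intro x y z
      have := congrArg₂ (· + ·) (p₁ x y z) (q₁ x y z)
      simp only [add_zero] at this
      rw [← this]; simp; abel
    · intro x y z
      refine (congrArg₂ (· + ·) (p₂ x y z) (q₂ x y z)).trans ?_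
      simp; abel
    · intro x y z
      refine (congrArg₂ (· + ·) (p₃ x y z) (q₃ x y z)).trans ?_
      simp; abel
    · intro x y z
      refine (congrArg₂ (· + ·) (p₄ x y z) (q₄ x y z)).trans ?_
      simp; abel
    · simp [p₅, q₅]
    · simp [p₆, q₆]
    · simp [p₇, q₇]
    · simp [p₈, q₈]
    · intro x y z t
      have := congrArg₂ (· + ·) (c₁ x y z t) (e₁ x y z t)
      simp only [add_zero] at this
      rw [← this]; simp; abel
    · intro x y z t
      have := congrArg₂ (· + ·) (c₂ x y z t) (e₂ x y z t)
      simp only [add_zero] at this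
      rw [← this]; simp; abel
    · intro x y z t
      have := congrArg₂ (· + ·) (c₃ x y z t) (e₃ x y z t)
      simp only [add_zero] at this
      rw [← this]; simp; abel
    · intro x y z t
      have := congrArg₂ (· + ·) (c₄ x y z t) (e₄ x y z t)
      simp only [add_zero] at this
      rw [← this]; simp; abel
  smul_mem' := by
    rintro c h ⟨⟨p₁, p₂, p₃, p₄, p₅, p₆, p₇, p₈⟩, ⟨c₁, c₂, c₃, c₄⟩⟩
    refine ⟨⟨?_, ?_, ?_, ?_, ?_, ?_, ?_, ?_⟩, ⟨?_, ?_, ?_, ?_⟩⟩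
    · intro x y z
      have := congrArg (c • ·) (p₁ x y z)
      simp only [smul_zero] at this
      rw [← this]; simp [smul_add, smul_sub]
    · intro x y z
      refine (congrArg (c • ·) (p₂ x y z)).trans ?_
      simp
    · intro x y z
      refine (congrArg (c • ·) (p₃ x y z)).trans ?_
      simp
    · intro x y z
      refine (congrArg (c • ·) (p₄ x y z)).trans ?_
      simp
    · simp [p₅]
    · simp [p₆]
    · simp [p₇]
    · simp [p₈]
    · intro x y z t
      have := congrArg (c • ·) (c₁ x y z t)
      simp only [smul_zero] at this
      rw [← this]; simp [smul_add, smul_sub]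
    · intro x y z t
      have := congrArg (c • ·) (c₂ x y z t)
      simp only [smul_zero] at this
      rw [← this]; simp [smul_add, smul_sub, smul_comm c]
    · intro x y z t
      have := congrArg (c • ·) (c₃ x y z t)
      simp only [smul_zero] at this
      rw [← this]; simp [smul_add, smul_sub]
    · intro x y z t
      have := congrArg (c • ·) (c₄ x y z t)
      simp only [smul_zero] at this
      rw [← this]; simp [smul_add, smul_sub, smul_comm c]

/-- The space `B³(G, M)` of `3`-coboundaries `dω`, where `ω` runs over the `2`-cochains. -/
def coboundaries₃ (ρ : HomLieRep G M) : Submodule k (TrilinearQuadruple G M) where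
  carrier := {h | ∃ ω : BilinearTriple G M, IsCochain₂ ω ∧ IsCoboundaryOf ρ h ω}
  zero_mem' := ⟨0, IsCochain₂.zero, by constructor <;> simp⟩
  add_mem' := by
    rintro h h' ⟨ω, hω, ⟨p₁, p₂, p₃, p₄⟩⟩ ⟨ω', hω', ⟨q₁, q₂, q₃, q₄⟩⟩
    refine ⟨ω + ω', hω.add hω', ?_⟩
    constructor
    · intro x y z; simp [p₁ x y z, q₁ x y z]; abel
    · intro x y z
      refine (congrArg₂ (· + ·) (p₂ x y z) (q₂ x y z)).trans ?_
      simp; abel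
    · intro x y z
      refine (congrArg₂ (· + ·) (p₃ x y z) (q₃ x y z)).trans ?_
      simp; abel
    · intro x y z; simp [p₄ x y z, q₄ x y z]; abel
  smul_mem' := by
    rintro c h ⟨ω, hω, ⟨p₁, p₂, p₃, p₄⟩⟩
    refine ⟨c • ω, hω.smul c, ?_⟩
    constructor
    · intro x y z; simp [p₁ x y z, smul_add, smul_sub]
    · intro x y z; simp [p₂ x y z, smul_add, smul_sub, smul_comm c]
    · intro x y z; simp [p₃ x y z, smul_add, smul_sub]
    · intro x y z; simp [p₄ x y z, smul_add]

/-- `d ∘ d = 0`: every `3`-coboundary is a `3`-cocycle. -/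
theorem coboundaries₃_le_cocycles₃ [CharZero k] (ρ : HomLieRep G M) :
    coboundaries₃ ρ ≤ cocycles₃ ρ := by
  rintro h ⟨ω, ⟨symm, skew, wα₀, wα₁, wα₂⟩, ⟨d₀, d₁, d₂, d₃⟩⟩
  have r100 (x y u) : ρ.ρ₁₀ (G.β y) (ρ.ρ₀₀ x u) = (2 : k) • ρ.ρ₁₀ (G.act x y) (M.α u) := by
    rw [ρ.act_even, smul_smul]; simp
  have r010 (x y u) : ρ.ρ₀₁ (G.α x) (ρ.ρ₁₀ y u) = ρ.ρ₁₀ (G.act x y) (M.α u) := by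
    rw [ρ.act_even, ρ.even_odd_even]
  have r1b (x y u) : ρ.ρ₁₀ (G.β x) (ρ.ρ₁₁ y u) =
      ρ.ρ₁₀ (G.β y) (ρ.ρ₁₁ x u) - ρ.ρ₀₁ (G.bracket x y) (M.β u) := by
    rw [ρ.bracket_odd]; abel
  refine ⟨⟨?_, ?_, ?_, ?_, ?_, ?_, ?_, ?_⟩, ⟨?_, ?_, ?_, ?_⟩⟩
  · intro a b c
    simp only [d₀, symm b a, symm c a, G.mul_comm b a, G.mul_comm c a,
      symm (G.mul a b), symm (G.mul b c)]
    abel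
  · intro a b c
    simp only [d₂, skew c b, G.bracket_skew c b, skew (G.act a c), skew (G.act a b), map_neg]
    abel
  · intro a b c
    simp only [d₃, skew c b, G.bracket_skew c b, skew b a, G.bracket_skew b a, skew c a,
      G.bracket_skew c a, map_neg, LinearMap.neg_apply]
    abel
  · intro a b c
    simp only [d₃, skew c b, G.bracket_skew c b, skew b a, G.bracket_skew b a, skew c a,
      G.bracket_skew c a, map_neg, LinearMap.neg_apply]
    abel
  · intro a b c
    simp only [d₀, map_add, map_sub, ρ.α_ρ₀₀, wα₀, G.α_mul]
  · intro a b c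
    simp only [d₁, map_add, map_sub, map_smul, ρ.β_ρ₀₁, ρ.β_ρ₁₀, wα₀, wα₁, G.α_mul, G.β_act]
  · intro a b c
    simp only [d₂, map_add, map_sub, ρ.α_ρ₀₀, ρ.α_ρ₁₁, wα₀, wα₁, wα₂, G.β_act, G.α_bracket]
  · intro a b c
    simp only [d₃, map_add, ρ.β_ρ₁₀, wα₁, wα₂, G.α_bracket]
  · intro a₁ a₂ a₃ a₄
    simp only [d₀, map_add, map_sub, ρ.even_even_even, wα₀, G.α_mul]
    simp only [G.hom_assoc, G.mul_comm (G.α a₄)]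
    abel
  · intro a₁ a₂ a₃ b
    simp only [d₀, d₁, map_add, map_sub, map_smul, ρ.even_even_odd, r010, r100, wα₀, wα₁, G.α_mul,
      G.β_act]
    simp only [G.hom_assoc, G.hom_act, map_smul]
    match_scalars <;> norm_num
  · intro a₁ a₂ b₁ b₂
    simp only [d₀, d₁, d₂, map_add, map_sub, map_smul, ρ.even_even_even, ρ.even_odd_odd, wα₁, wα₂,
      G.β_act, G.α_bracket]
    simp only [G.hom_act, G.hom_deriv, map_smul, map_add]
    simp only [symm a₂ a₁, G.mul_comm a₂ a₁, symm (G.α a₂) (G.α a₁),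
      G.mul_comm (G.α a₂) (G.α a₁)]
    match_scalars <;> norm_num
  · intro a b₁ b₂ b₃
    simp only [d₁, d₂, d₃, map_add, map_sub, r010, r100, wα₂, G.β_act, G.α_bracket]
    have e1 := r1b (G.β b₃) (G.β b₂) (ω.2.1 a b₁)
    have e2 := r1b (G.β b₁) (G.β b₃) (ω.2.1 a b₂)
    have e3 := r1b (G.β b₂) (G.β b₁) (ω.2.1 a b₃)
    simp only [wα₁] at e1 e2 e3
    rw [e1, e2, e3]
    simp only [G.mul_comm (G.bracket _ _) (G.α a)]
    simp only [G.hom_deriv, map_add, LinearMap.add_apply]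
    simp only [symm _ (G.α a), G.bracket_skew (G.β b₃) (G.act a b₁),
      G.bracket_skew (G.β b₂) (G.act a b₃), G.bracket_skew (G.β b₁) (G.act a b₂),
      G.bracket_skew (G.β b₃) (G.β b₂), G.bracket_skew (G.β b₂) (G.β b₁),
      G.bracket_skew (G.β b₁) (G.β b₃), map_neg, LinearMap.neg_apply]
    have J := congrArg (ω.2.1 (G.α (G.α a))) (G.hom_jacobi b₁ b₂ b₃)
    simp only [map_add, map_zero] at J
    clear e1 e2 e3
    linear_combination (norm := module) (3 : k) • J

/-- The third cohomology `H³(G, M) = Z³(G, M) / B³(G, M)`. -/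
abbrev H₃ (ρ : HomLieRep G M) : Type (max u₁ u₂) :=
  cocycles₃ ρ ⧸ (coboundaries₃ ρ).comap (cocycles₃ ρ).subtype

end Cohomology

/-! ### Crossed module extensions -/

section Extensions

variable {k : Type v} [Field k] {G : HomLieAntialgebra.{v, u₁} k} {M : HomSuperSpace.{v, u₂} k}

/-- A crossed module extension `0 → M → V → A → G → 0` of the Hom-Lie antialgebra `G` by the
representation `(M, ρ)`: an exact sequence of Hom-Lie antialgebras in which `d : V → A` is a crossed
module, where `M` has the zero product and the action of `A` on `V` induces on `M` the given
representation of `G`. -/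
structure CrossedModuleExtension (ρ : HomLieRep G M) where
  V : HomLieAntialgebra.{v, w} k
  A : HomLieAntialgebra.{v, w} k
  action : HomLieAction A V
  i : M.trivialAlgebra.Hom V
  d : V.Hom A
  p : A.Hom G
  crossed : IsCrossedModule action d
  i_even_injective : Function.Injective i.even
  i_odd_injective : Function.Injective i.odd
  exact_V_even : Function.Exact i.even d.even
  exact_V_odd : Function.Exact i.odd d.odd
  exact_A_even : Function.Exact d.even p.even
  exact_A_odd : Function.Exact d.odd p.odd
  p_even_surjective : Function.Surjective p.even
  p_odd_surjective : Function.Surjective p.odd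
  induced_ρ₀₀ : ∀ x m, action.ρ₀₀ x (i.even m) = i.even (ρ.ρ₀₀ (p.even x) m)
  induced_ρ₀₁ : ∀ x n, action.ρ₀₁ x (i.odd n) = i.odd (ρ.ρ₀₁ (p.even x) n)
  induced_ρ₁₀ : ∀ y m, action.ρ₁₀ y (i.even m) = i.odd (ρ.ρ₁₀ (p.odd y) m)
  induced_ρ₁₁ : ∀ y n, action.ρ₁₁ y (i.odd n) = i.even (ρ.ρ₁₁ (p.odd y) n)

namespace CrossedModuleExtension

variable {ρ : HomLieRep G M}

/-- A morphism of crossed module extensions that is the identity on `M` and on `G`. -/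
structure Morphism (E E' : CrossedModuleExtension.{v, u₁, u₂, w} ρ) where
  φ : E.V.Hom E'.V
  ψ : E.A.Hom E'.A
  φ_ρ₀₀ : ∀ x u, φ.even (E.action.ρ₀₀ x u) = E'.action.ρ₀₀ (ψ.even x) (φ.even u)
  φ_ρ₀₁ : ∀ x w, φ.odd (E.action.ρ₀₁ x w) = E'.action.ρ₀₁ (ψ.even x) (φ.odd w)
  φ_ρ₁₀ : ∀ y u, φ.odd (E.action.ρ₁₀ y u) = E'.action.ρ₁₀ (ψ.odd y) (φ.even u)
  φ_ρ₁₁ : ∀ y w, φ.even (E.action.ρ₁₁ y w) = E'.action.ρ₁₁ (ψ.odd y) (φ.odd w)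
  φ_i_even : ∀ m, φ.even (E.i.even m) = E'.i.even m
  φ_i_odd : ∀ n, φ.odd (E.i.odd n) = E'.i.odd n
  d_φ_even : ∀ u, E'.d.even (φ.even u) = ψ.even (E.d.even u)
  d_φ_odd : ∀ w, E'.d.odd (φ.odd w) = ψ.odd (E.d.odd w)
  p_ψ_even : ∀ x, E'.p.even (ψ.even x) = E.p.even x
  p_ψ_odd : ∀ y, E'.p.odd (ψ.odd y) = E.p.odd y

/-- Linear sections `s` of `p : A → G` and `σ` of `d : V → Ker p = Im d` in the category of Hom-super
vector spaces, that is, commuting with the structure maps `α` and `β`. -/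
structure Sections (E : CrossedModuleExtension.{v, u₁, u₂, w} ρ) where
  s₀ : G.Even →ₗ[k] E.A.Even
  s₁ : G.Odd →ₗ[k] E.A.Odd
  σ₀ : LinearMap.ker E.p.even →ₗ[k] E.V.Even
  σ₁ : LinearMap.ker E.p.odd →ₗ[k] E.V.Odd
  p_s₀ : ∀ a, E.p.even (s₀ a) = a
  p_s₁ : ∀ b, E.p.odd (s₁ b) = b
  d_σ₀ : ∀ n, E.d.even (σ₀ n) = n
  d_σ₁ : ∀ n, E.d.odd (σ₁ n) = n
  s₀_α : ∀ a, s₀ (G.α a) = E.A.α (s₀ a)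
  s₁_β : ∀ b, s₁ (G.β b) = E.A.β (s₁ b)
  σ₀_α : ∀ n n' : LinearMap.ker E.p.even, (n' : E.A.Even) = E.A.α n → σ₀ n' = E.V.α (σ₀ n)
  σ₁_β : ∀ n n' : LinearMap.ker E.p.odd, (n' : E.A.Odd) = E.A.β n → σ₁ n' = E.V.β (σ₁ n)

namespace Sections

variable {E : CrossedModuleExtension.{v, u₁, u₂, w} ρ} (S : E.Sections)

def ω₀ (a₁ a₂ : G.Even) : E.V.Even :=
  S.σ₀ ⟨E.A.mul (S.s₀ a₁) (S.s₀ a₂) - S.s₀ (G.mul a₁ a₂), by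
    simp [E.p.map_mul, S.p_s₀]⟩

def ω₁ (a : G.Even) (b : G.Odd) : E.V.Odd :=
  S.σ₁ ⟨E.A.act (S.s₀ a) (S.s₁ b) - S.s₁ (G.act a b), by
    simp [E.p.map_act, S.p_s₀, S.p_s₁]⟩

def ω₂ (b₁ b₂ : G.Odd) : E.V.Even :=
  S.σ₀ ⟨E.A.bracket (S.s₁ b₁) (S.s₁ b₂) - S.s₀ (G.bracket b₁ b₂), by
    simp [E.p.map_bracket, S.p_s₀, S.p_s₁]⟩

def h₀ (a₁ a₂ a₃ : G.Even) : E.V.Even :=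
  E.action.ρ₀₀ (S.s₀ (G.α a₁)) (S.ω₀ a₂ a₃) + S.ω₀ (G.α a₁) (G.mul a₂ a₃)
    - E.action.ρ₀₀ (S.s₀ (G.α a₃)) (S.ω₀ a₁ a₂) - S.ω₀ (G.mul a₁ a₂) (G.α a₃)

def h₁ (a₁ a₂ : G.Even) (b : G.Odd) : E.V.Odd :=
  E.action.ρ₀₁ (S.s₀ (G.α a₁)) (S.ω₁ a₂ b) + S.ω₁ (G.α a₁) (G.act a₂ b)
    - (2⁻¹ : k) • E.action.ρ₁₀ (S.s₁ (G.β b)) (S.ω₀ a₁ a₂)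
    - (2⁻¹ : k) • S.ω₁ (G.mul a₁ a₂) (G.β b)

def h₂ (a : G.Even) (b₁ b₂ : G.Odd) : E.V.Even :=
  E.action.ρ₀₀ (S.s₀ (G.α a)) (S.ω₂ b₁ b₂) + S.ω₀ (G.α a) (G.bracket b₁ b₂)
    + E.action.ρ₁₁ (S.s₁ (G.β b₂)) (S.ω₁ a b₁) - S.ω₂ (G.act a b₁) (G.β b₂)
    - E.action.ρ₁₁ (S.s₁ (G.β b₁)) (S.ω₁ a b₂) - S.ω₂ (G.β b₁) (G.act a b₂)

def h₃ (b₁ b₂ b₃ : G.Odd) : E.V.Odd :=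
  E.action.ρ₁₀ (S.s₁ (G.β b₁)) (S.ω₂ b₂ b₃) + S.ω₁ (G.bracket b₂ b₃) (G.β b₁)
    + E.action.ρ₁₀ (S.s₁ (G.β b₂)) (S.ω₂ b₃ b₁) + S.ω₁ (G.bracket b₃ b₁) (G.β b₂)
    + E.action.ρ₁₀ (S.s₁ (G.β b₃)) (S.ω₂ b₁ b₂) + S.ω₁ (G.bracket b₁ b₂) (G.β b₃)

/-- The maps `(h₀, h₁, h₂, h₃)` built from the sections take their values in `M`, where they are
given by the quadruple `h`. -/
structure Represents (h : TrilinearQuadruple G M) : Prop where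
  eq₀ : ∀ a₁ a₂ a₃, E.i.even (h.1 a₁ a₂ a₃) = S.h₀ a₁ a₂ a₃
  eq₁ : ∀ a₁ a₂ b, E.i.odd (h.2.1 a₁ a₂ b) = S.h₁ a₁ a₂ b
  eq₂ : ∀ a b₁ b₂, E.i.even (h.2.2.1 a b₁ b₂) = S.h₂ a b₁ b₂
  eq₃ : ∀ b₁ b₂ b₃, E.i.odd (h.2.2.2 b₁ b₂ b₃) = S.h₃ b₁ b₂ b₃

end Sections

end CrossedModuleExtension

/-- The crossed module extensions of `G` by `(M, ρ)` that split as sequences of Hom-super vector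
spaces. -/
def SplitExtension (ρ : HomLieRep G M) :=
  {E : CrossedModuleExtension.{v, u₁, u₂, w} ρ // Nonempty E.Sections}

/-- The equivalence classes of crossed module extensions, for the equivalence relation generated by
the existence of a morphism that is the identity on `M` and on `G`. -/
def CExt (ρ : HomLieRep G M) :=
  Quot fun E E' : SplitExtension.{v, u₁, u₂, w} ρ => Nonempty (E.1.Morphism E'.1)

def CExt.mk {ρ : HomLieRep G M} (E : SplitExtension.{v, u₁, u₂, w} ρ) :
    CExt.{v, u₁, u₂, w} ρ :=
  Quot.mk _ E

end Extensions

/-! Along a section `s`, the products of `𝔞` are those of `𝔤` up to an error `dω`, and `h` is the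
coboundary formula applied to `ω` with the action of `𝔞` at `s`. Since `d` turns that action into
multiplication in `𝔞`, `d h` is a defining identity of `𝔞` at `s` minus `s` of the same identity of
`𝔤`. So `d h = 0`, and exactness puts `h` in `M`.

For the cocycle condition one repeats the computation of `d ∘ d = 0`. The operators at `s` satisfy
the relations of a representation of `𝔤` up to the action of elements `dω(x, y)`, which by the
Peiffer identities is multiplication by `ω(x, y)` in `V`. The only new terms are therefore quadratic
in `ω`, and they cancel by the (skew-)symmetry of `ω` and of the products of `V`.

Independence of choices is proved for the flexible notion of a `Lift`: a pair `(s, ω)` in which `ω`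
is any equivariant cochain lifting the error of `s`, not necessarily `σ` of the error. Three moves
suffice. (1) With `s` fixed, two choices of `ω` differ by an `M`-valued cochain `η`, and `h` changes
by `dη` (`Represents.sub_mem_of_section_eq`). (2) Replacing `s` by `s + dF` and `ω` by `ω + ρ(s)F +
F·F - F(product)` leaves `h` unchanged on the nose (`Represents.translate`). Any two sections are
related in this way, because `σ` lifts their difference equivariantly. (3) A morphism of extensions
carries a lift to a lift with the same `h` (`Lift.Represents.map`), although it need not respect any
`σ`. -/

/-- A trilinear map from a function that is linear in each of its three arguments. -/
def LinearMap.mk₃ {R M₁ M₂ M₃ N : Type*} [CommSemiring R] [AddCommMonoid M₁] [AddCommMonoid M₂]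
    [AddCommMonoid M₃] [AddCommMonoid N] [Module R M₁] [Module R M₂] [Module R M₃] [Module R N]
    (f : M₁ → M₂ → M₃ → N)
    (add₁ : ∀ x x' y z, f (x + x') y z = f x y z + f x' y z)
    (smul₁ : ∀ (c : R) x y z, f (c • x) y z = c • f x y z)
    (add₂ : ∀ x y y' z, f x (y + y') z = f x y z + f x y' z)
    (smul₂ : ∀ (c : R) x y z, f x (c • y) z = c • f x y z)
    (add₃ : ∀ x y z z', f x y (z + z') = f x y z + f x y z')
    (smul₃ : ∀ (c : R) x y z, f x y (c • z) = c • f x y z) : M₁ →ₗ[R] M₂ →ₗ[R] M₃ →ₗ[R] N where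
  toFun x := LinearMap.mk₂ R (f x) (add₂ x) (smul₂ · x) (add₃ x) (smul₃ · x)
  map_add' x x' := by ext y z; exact add₁ x x' y z
  map_smul' c x := by ext y z; exact smul₁ c x y z

/-! ### Lifts and their obstruction. -/

namespace CrossedModuleExtension

variable {k : Type v} [Field k] {G : HomLieAntialgebra.{v, u₁} k} {M : HomSuperSpace.{v, u₂} k}
  {ρ : HomLieRep G M}

/-- A linear section `s` of `p : A → G`, commuting with the structure maps, together with a
`2`-cochain `ω` of `G` with values in `V` that lifts the failure of `s` to be a homomorphism. -/
structure Lift (E : CrossedModuleExtension.{v, u₁, u₂, w} ρ) where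
  s₀ : G.Even →ₗ[k] E.A.Even
  s₁ : G.Odd →ₗ[k] E.A.Odd
  ω : BilinearTriple G E.V.toHomSuperSpace
  p_s₀ : ∀ a, E.p.even (s₀ a) = a
  p_s₁ : ∀ b, E.p.odd (s₁ b) = b
  s₀_α : ∀ a, s₀ (G.α a) = E.A.α (s₀ a)
  s₁_β : ∀ b, s₁ (G.β b) = E.A.β (s₁ b)
  cochain : IsCochain₂ ω
  mul_s : ∀ a₁ a₂, E.A.mul (s₀ a₁) (s₀ a₂) = s₀ (G.mul a₁ a₂) + E.d.even (ω.1 a₁ a₂)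
  act_s : ∀ a b, E.A.act (s₀ a) (s₁ b) = s₁ (G.act a b) + E.d.odd (ω.2.1 a b)
  bracket_s : ∀ b₁ b₂,
    E.A.bracket (s₁ b₁) (s₁ b₂) = s₀ (G.bracket b₁ b₂) + E.d.even (ω.2.2 b₁ b₂)

namespace Lift

variable {E : CrossedModuleExtension.{v, u₁, u₂, w} ρ} (L : E.Lift)

/-- The maps `(h₀, h₁, h₂, h₃)` with values in `V`, given by the coboundary formula for `ω`. -/
def obstruction : TrilinearQuadruple G E.V.toHomSuperSpace :=
  (.mk₃ (fun a₁ a₂ a₃ =>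
      E.action.ρ₀₀ (L.s₀ (G.α a₁)) (L.ω.1 a₂ a₃) + L.ω.1 (G.α a₁) (G.mul a₂ a₃)
        - E.action.ρ₀₀ (L.s₀ (G.α a₃)) (L.ω.1 a₁ a₂) - L.ω.1 (G.mul a₁ a₂) (G.α a₃))
      (by intros; simp; abel) (by intros; simp [smul_sub]) (by intros; simp; abel)
      (by intros; simp [smul_sub]) (by intros; simp; abel) (by intros; simp [smul_sub]),
    .mk₃ (fun a₁ a₂ b =>
      E.action.ρ₀₁ (L.s₀ (G.α a₁)) (L.ω.2.1 a₂ b) + L.ω.2.1 (G.α a₁) (G.act a₂ b)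
        - (2⁻¹ : k) • E.action.ρ₁₀ (L.s₁ (G.β b)) (L.ω.1 a₁ a₂)
        - (2⁻¹ : k) • L.ω.2.1 (G.mul a₁ a₂) (G.β b))
      (by intros; simp; abel) (by intros; simp; module) (by intros; simp; abel)
      (by intros; simp; module) (by intros; simp; abel) (by intros; simp; module),
    .mk₃ (fun a b₁ b₂ =>
      E.action.ρ₀₀ (L.s₀ (G.α a)) (L.ω.2.2 b₁ b₂) + L.ω.1 (G.α a) (G.bracket b₁ b₂)
        + E.action.ρ₁₁ (L.s₁ (G.β b₂)) (L.ω.2.1 a b₁) - L.ω.2.2 (G.act a b₁) (G.β b₂)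
        - E.action.ρ₁₁ (L.s₁ (G.β b₁)) (L.ω.2.1 a b₂) - L.ω.2.2 (G.β b₁) (G.act a b₂))
      (by intros; simp; abel) (by intros; simp; module) (by intros; simp; abel)
      (by intros; simp; module) (by intros; simp; abel) (by intros; simp; module),
    .mk₃ (fun b₁ b₂ b₃ =>
      E.action.ρ₁₀ (L.s₁ (G.β b₁)) (L.ω.2.2 b₂ b₃) + L.ω.2.1 (G.bracket b₂ b₃) (G.β b₁)
        + E.action.ρ₁₀ (L.s₁ (G.β b₂)) (L.ω.2.2 b₃ b₁) + L.ω.2.1 (G.bracket b₃ b₁) (G.β b₂)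
        + E.action.ρ₁₀ (L.s₁ (G.β b₃)) (L.ω.2.2 b₁ b₂) + L.ω.2.1 (G.bracket b₁ b₂) (G.β b₃))
      (by intros; simp; abel) (by intros; simp) (by intros; simp; abel)
      (by intros; simp) (by intros; simp; abel) (by intros; simp))

theorem obstruction₀_apply (a₁ a₂ a₃) : L.obstruction.1 a₁ a₂ a₃ =
    E.action.ρ₀₀ (L.s₀ (G.α a₁)) (L.ω.1 a₂ a₃) + L.ω.1 (G.α a₁) (G.mul a₂ a₃)
      - E.action.ρ₀₀ (L.s₀ (G.α a₃)) (L.ω.1 a₁ a₂) - L.ω.1 (G.mul a₁ a₂) (G.α a₃) := rfl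

theorem obstruction₁_apply (a₁ a₂ b) : L.obstruction.2.1 a₁ a₂ b =
    E.action.ρ₀₁ (L.s₀ (G.α a₁)) (L.ω.2.1 a₂ b) + L.ω.2.1 (G.α a₁) (G.act a₂ b)
      - (2⁻¹ : k) • E.action.ρ₁₀ (L.s₁ (G.β b)) (L.ω.1 a₁ a₂)
      - (2⁻¹ : k) • L.ω.2.1 (G.mul a₁ a₂) (G.β b) := rfl

theorem obstruction₂_apply (a b₁ b₂) : L.obstruction.2.2.1 a b₁ b₂ =
    E.action.ρ₀₀ (L.s₀ (G.α a)) (L.ω.2.2 b₁ b₂) + L.ω.1 (G.α a) (G.bracket b₁ b₂)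
      + E.action.ρ₁₁ (L.s₁ (G.β b₂)) (L.ω.2.1 a b₁) - L.ω.2.2 (G.act a b₁) (G.β b₂)
      - E.action.ρ₁₁ (L.s₁ (G.β b₁)) (L.ω.2.1 a b₂) - L.ω.2.2 (G.β b₁) (G.act a b₂) := rfl

theorem obstruction₃_apply (b₁ b₂ b₃) : L.obstruction.2.2.2 b₁ b₂ b₃ =
    E.action.ρ₁₀ (L.s₁ (G.β b₁)) (L.ω.2.2 b₂ b₃) + L.ω.2.1 (G.bracket b₂ b₃) (G.β b₁)
      + E.action.ρ₁₀ (L.s₁ (G.β b₂)) (L.ω.2.2 b₃ b₁) + L.ω.2.1 (G.bracket b₃ b₁) (G.β b₂)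
      + E.action.ρ₁₀ (L.s₁ (G.β b₃)) (L.ω.2.2 b₁ b₂) + L.ω.2.1 (G.bracket b₁ b₂) (G.β b₃) := rfl

/-! ### The obstruction is a cochain with values in the kernel of `d`. -/

theorem d_ω₀ (a₁ a₂) :
    E.d.even (L.ω.1 a₁ a₂) = E.A.mul (L.s₀ a₁) (L.s₀ a₂) - L.s₀ (G.mul a₁ a₂) := by
  rw [L.mul_s]; abel

theorem d_ω₁ (a b) :
    E.d.odd (L.ω.2.1 a b) = E.A.act (L.s₀ a) (L.s₁ b) - L.s₁ (G.act a b) := by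
  rw [L.act_s]; abel

theorem d_ω₂ (b₁ b₂) :
    E.d.even (L.ω.2.2 b₁ b₂) = E.A.bracket (L.s₁ b₁) (L.s₁ b₂) - L.s₀ (G.bracket b₁ b₂) := by
  rw [L.bracket_s]; abel

/-- After `d`, the mixed terms, products of an `s` with an `s` of a product, cancel. What remains is
the associativity defect of `𝔞` at `s` minus `s` of that of `𝔤`, and both vanish. The other three
components follow the same pattern. -/
theorem d_obstruction₀ (a₁ a₂ a₃) : E.d.even (L.obstruction.1 a₁ a₂ a₃) = 0 := by
  simp only [obstruction₀_apply, map_add, map_sub, E.crossed.d_ρ₀₀, L.d_ω₀, L.s₀_α,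
    E.A.hom_assoc, G.hom_assoc, E.A.mul_comm (E.A.α (L.s₀ a₃)), LinearMap.sub_apply]
  abel

theorem d_obstruction₁ (a₁ a₂ b) : E.d.odd (L.obstruction.2.1 a₁ a₂ b) = 0 := by
  simp only [obstruction₁_apply, map_add, map_sub, map_smul, E.crossed.d_ρ₀₁, E.crossed.d_ρ₁₀,
    L.d_ω₀, L.d_ω₁, L.s₀_α, L.s₁_β, E.A.hom_act, G.hom_act, LinearMap.sub_apply]
  module

theorem d_obstruction₂ (a b₁ b₂) : E.d.even (L.obstruction.2.2.1 a b₁ b₂) = 0 := by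
  simp only [obstruction₂_apply, map_add, map_sub, E.crossed.d_ρ₀₀, E.crossed.d_ρ₁₁,
    L.d_ω₀, L.d_ω₁, L.d_ω₂, L.s₀_α, L.s₁_β, E.A.hom_deriv, G.hom_deriv,
    E.A.bracket_skew (E.A.β (L.s₁ b₂)), LinearMap.sub_apply]
  abel

theorem d_obstruction₃ (b₁ b₂ b₃) : E.d.odd (L.obstruction.2.2.2 b₁ b₂ b₃) = 0 := by
  have hA := E.A.hom_jacobi (L.s₁ b₁) (L.s₁ b₂) (L.s₁ b₃)
  have hG := congrArg L.s₁ (G.hom_jacobi b₁ b₂ b₃)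
  simp only [map_add, map_zero] at hG
  simp only [obstruction₃_apply, map_add, map_sub, E.crossed.d_ρ₁₀,
    L.d_ω₁, L.d_ω₂, L.s₁_β, LinearMap.sub_apply]
  -- The Jacobi identity is a relation between three terms, not a rewriting rule, so it enters as a
  -- linear combination.
  linear_combination (norm := abel) hA - hG

/-- These are formal consequences of the symmetries and the equivariance of `ω`, `s` and the action;
that `ω` lifts the error of `s` plays no role. -/
theorem obstruction_isCochain₃ : IsCochain₃ L.obstruction := by
  obtain ⟨symm, skew, wα₀, wα₁, wα₂⟩ := L.cochain
  refine ⟨?_, ?_, ?_, ?_, ?_, ?_, ?_, ?_⟩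
  · intro a b c
    simp only [obstruction₀_apply, symm b a, symm c a, G.mul_comm b a, G.mul_comm c a,
      symm (G.mul a b), symm (G.mul b c)]
    abel
  · intro a b c
    simp only [obstruction₂_apply, skew c b, G.bracket_skew c b, skew (G.act a c),
      skew (G.act a b), map_neg]
    abel
  · intro a b c
    simp only [obstruction₃_apply, skew c b, G.bracket_skew c b, skew b a, G.bracket_skew b a,
      skew c a, G.bracket_skew c a, map_neg, LinearMap.neg_apply]
    abel
  · intro a b c
    simp only [obstruction₃_apply, skew c b, G.bracket_skew c b, skew b a, G.bracket_skew b a,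
      skew c a, G.bracket_skew c a, map_neg, LinearMap.neg_apply]
    abel
  · intro a b c
    simp only [obstruction₀_apply, map_add, map_sub, E.action.α_ρ₀₀, wα₀, G.α_mul, L.s₀_α]
  · intro a b c
    simp only [obstruction₁_apply, map_add, map_sub, map_smul, E.action.β_ρ₀₁, E.action.β_ρ₁₀,
      wα₀, wα₁, G.α_mul, G.β_act, L.s₀_α, L.s₁_β]
  · intro a b c
    simp only [obstruction₂_apply, map_add, map_sub, E.action.α_ρ₀₀, E.action.α_ρ₁₁,
      wα₀, wα₁, wα₂, G.β_act, G.α_bracket, L.s₀_α, L.s₁_β]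
  · intro a b c
    simp only [obstruction₃_apply, map_add, E.action.β_ρ₁₀, wα₁, wα₂, G.α_bracket, L.s₁_β]

/-! ### The relations of a representation along `s`, and closedness of the obstruction. -/

/-- The product `s x · s y` is `s (x y) + dω(x, y)`, and the Peiffer identity replaces the action of
`dω(x, y)` by multiplication by `ω(x, y)`. The next relations carry the same kind of correction. -/
theorem ρ₀₀_ρ₀₀ (x y u) : E.action.ρ₀₀ (L.s₀ (G.α x)) (E.action.ρ₀₀ (L.s₀ y) u) =
    E.action.ρ₀₀ (L.s₀ (G.mul x y)) (E.V.α u) + E.V.mul (L.ω.1 x y) (E.V.α u) := by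
  rw [L.s₀_α, E.action.even_even_even, L.mul_s, map_add, LinearMap.add_apply,
    E.crossed.peiffer_mul]

theorem ρ₀₁_ρ₀₁ (x y v) : E.action.ρ₀₁ (L.s₀ (G.α x)) (E.action.ρ₀₁ (L.s₀ y) v) =
    (2⁻¹ : k) • (E.action.ρ₀₁ (L.s₀ (G.mul x y)) (E.V.β v) +
      E.V.act (L.ω.1 x y) (E.V.β v)) := by
  rw [L.s₀_α, E.action.even_even_odd, L.mul_s, map_add, LinearMap.add_apply,
    E.crossed.peiffer_act]

theorem ρ₀₁_ρ₁₀ (x y u) : E.action.ρ₀₁ (L.s₀ (G.α x)) (E.action.ρ₁₀ (L.s₁ y) u) =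
    E.action.ρ₁₀ (L.s₁ (G.act x y)) (E.V.α u) + E.V.act (E.V.α u) (L.ω.2.1 x y) := by
  rw [L.s₀_α, E.action.even_odd_even, ← E.action.act_even, L.act_s, map_add,
    LinearMap.add_apply, E.crossed.peiffer_act']

theorem ρ₁₀_ρ₀₀ [CharZero k] (x y u) :
    E.action.ρ₁₀ (L.s₁ (G.β y)) (E.action.ρ₀₀ (L.s₀ x) u) =
      (2 : k) • (E.action.ρ₁₀ (L.s₁ (G.act x y)) (E.V.α u) +
        E.V.act (E.V.α u) (L.ω.2.1 x y)) := by
  rw [← L.ρ₀₁_ρ₁₀, L.s₀_α, E.action.even_odd_even, smul_smul, L.s₁_β]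
  simp

theorem ρ₀₀_ρ₁₁ (x y v) : E.action.ρ₀₀ (L.s₀ (G.α x)) (E.action.ρ₁₁ (L.s₁ y) v) =
    E.action.ρ₁₁ (L.s₁ (G.act x y)) (E.V.β v) + E.V.bracket (L.ω.2.1 x y) (E.V.β v) +
      E.action.ρ₁₁ (L.s₁ (G.β y)) (E.action.ρ₀₁ (L.s₀ x) v) := by
  rw [L.s₀_α, L.s₁_β, E.action.even_odd_odd, L.act_s, map_add,
    LinearMap.add_apply, E.crossed.peiffer_bracket]

/-- The bracket relation in the form of a swap of two odd operators; it can thus be applied to one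
of two opposite terms so that it meets the other. -/
theorem ρ₁₁_ρ₁₀ (x y u) : E.action.ρ₁₁ (L.s₁ (G.β x)) (E.action.ρ₁₀ (L.s₁ y) u) =
    E.action.ρ₁₁ (L.s₁ (G.β y)) (E.action.ρ₁₀ (L.s₁ x) u) +
      E.action.ρ₀₀ (L.s₀ (G.bracket x y)) (E.V.α u) + E.V.mul (L.ω.2.2 x y) (E.V.α u) := by
  have h := E.action.bracket_even (L.s₁ x) (L.s₁ y) u
  rw [L.bracket_s, map_add, LinearMap.add_apply, E.crossed.peiffer_mul] at h
  rw [L.s₁_β, L.s₁_β, add_assoc, h]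
  abel

theorem ρ₁₀_ρ₁₁ (x y v) : E.action.ρ₁₀ (L.s₁ (G.β x)) (E.action.ρ₁₁ (L.s₁ y) v) =
    E.action.ρ₁₀ (L.s₁ (G.β y)) (E.action.ρ₁₁ (L.s₁ x) v) -
      E.action.ρ₀₁ (L.s₀ (G.bracket x y)) (E.V.β v) - E.V.act (L.ω.2.2 x y) (E.V.β v) := by
  have h := E.action.bracket_odd (L.s₁ x) (L.s₁ y) v
  rw [L.bracket_s, map_add, LinearMap.add_apply, E.crossed.peiffer_act] at h
  rw [L.s₁_β, L.s₁_β, sub_sub, h]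
  abel

/-- The quadratic terms are products of two values of `ω₀`, with the four arguments split between
them; they cancel in pairs by commutativity of `V` and symmetry of `ω₀`. -/
theorem obstruction_closed₀ (a₁ a₂ a₃ a₄) :
    E.action.ρ₀₀ (L.s₀ (G.α (G.α a₁))) (L.obstruction.1 a₂ a₃ a₄)
      - L.obstruction.1 (G.mul a₁ a₂) (G.α a₃) (G.α a₄)
      + L.obstruction.1 (G.α a₁) (G.mul a₂ a₃) (G.α a₄)
      - L.obstruction.1 (G.α a₁) (G.α a₂) (G.mul a₃ a₄)
      + E.action.ρ₀₀ (L.s₀ (G.α (G.α a₄))) (L.obstruction.1 a₁ a₂ a₃) = 0 := by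
  obtain ⟨symm, skew, wα₀, wα₁, wα₂⟩ := L.cochain
  simp only [obstruction₀_apply, map_add, map_sub, L.ρ₀₀_ρ₀₀, wα₀, G.α_mul]
  simp only [G.hom_assoc, G.mul_comm (G.α a₄), symm (G.α a₄),
    E.V.mul_comm (L.ω.1 (G.α a₃) (G.α a₄))]
  abel

/-- The factor `1/4` meets the factor `2` of `ρ₁₀_ρ₀₀`: this gives the `1/2` that cancels the
quadratic terms from `ρ₀₁_ρ₀₁` and from the `1/2` in `h₁`. -/
theorem obstruction_closed₁ [CharZero k] (a₁ a₂ a₃ b) :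
    E.action.ρ₀₁ (L.s₀ (G.α (G.α a₁))) (L.obstruction.2.1 a₂ a₃ b)
      - L.obstruction.2.1 (G.α a₁) (G.α a₂) (G.act a₃ b)
      + (2⁻¹ : k) • L.obstruction.2.1 (G.α a₁) (G.mul a₂ a₃) (G.β b)
      - (2⁻¹ : k) • L.obstruction.2.1 (G.mul a₁ a₂) (G.α a₃) (G.β b)
      + (4⁻¹ : k) • E.action.ρ₁₀ (L.s₁ (G.β (G.β b))) (L.obstruction.1 a₁ a₂ a₃) = 0 := by
  obtain ⟨symm, skew, wα₀, wα₁, wα₂⟩ := L.cochain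
  simp only [obstruction₀_apply, obstruction₁_apply, map_add, map_sub, map_smul, L.ρ₀₁_ρ₀₁,
    L.ρ₀₁_ρ₁₀, L.ρ₁₀_ρ₀₀, wα₀, wα₁, G.α_mul, G.β_act]
  simp only [G.hom_assoc, G.hom_act, map_smul]
  match_scalars <;> norm_num

/-- Terms symmetric in `a₁, a₂` drop out of the difference, among them `ρ₁₁ ρ₁₀ ω₀(a₁, a₂)` and
`ω₀(a₁, a₂) ω₂(b₁, b₂)` with twisted arguments. The brackets of two values of `ω₁` cancel by
skew-symmetry. -/
theorem obstruction_closed₂ [CharZero k] (a₁ a₂ b₁ b₂) :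
    (E.action.ρ₀₀ (L.s₀ (G.α (G.α a₁))) (L.obstruction.2.2.1 a₂ b₁ b₂)
      + L.obstruction.2.2.1 (G.α a₁) (G.act a₂ b₁) (G.β b₂)
      + L.obstruction.2.2.1 (G.α a₁) (G.β b₁) (G.act a₂ b₂)
      - E.action.ρ₁₁ (L.s₁ (G.β (G.β b₂))) (L.obstruction.2.1 a₁ a₂ b₁)
      + E.action.ρ₁₁ (L.s₁ (G.β (G.β b₁))) (L.obstruction.2.1 a₁ a₂ b₂)
      - L.obstruction.1 (G.α a₁) (G.α a₂) (G.bracket b₁ b₂)) -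
    (E.action.ρ₀₀ (L.s₀ (G.α (G.α a₂))) (L.obstruction.2.2.1 a₁ b₁ b₂)
      + L.obstruction.2.2.1 (G.α a₂) (G.act a₁ b₁) (G.β b₂)
      + L.obstruction.2.2.1 (G.α a₂) (G.β b₁) (G.act a₁ b₂)
      - E.action.ρ₁₁ (L.s₁ (G.β (G.β b₂))) (L.obstruction.2.1 a₂ a₁ b₁)
      + E.action.ρ₁₁ (L.s₁ (G.β (G.β b₁))) (L.obstruction.2.1 a₂ a₁ b₂)
      - L.obstruction.1 (G.α a₂) (G.α a₁) (G.bracket b₁ b₂)) = 0 := by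
  obtain ⟨symm, skew, wα₀, wα₁, wα₂⟩ := L.cochain
  simp only [obstruction₀_apply, obstruction₁_apply, obstruction₂_apply, map_add, map_sub,
    map_smul, L.ρ₀₀_ρ₀₀, L.ρ₀₀_ρ₁₁, wα₁, wα₂, G.β_act, G.α_bracket]
  simp only [G.hom_act, G.hom_deriv, map_smul, map_add]
  simp only [symm a₂ a₁, G.mul_comm a₂ a₁, symm (G.α a₂) (G.α a₁),
    G.mul_comm (G.α a₂) (G.α a₁), E.V.bracket_skew (L.ω.2.1 (G.α a₁) _)]
  match_scalars <;> norm_num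

/-- The coefficient `3` balances the quadratic terms: `ρ₁₀_ρ₀₀` contributes `2`, the swap of two odd
operators contributes `1`, and `3 ρ₀₁ h₃` removes them. -/
theorem obstruction_closed₃ [CharZero k] (a b₁ b₂ b₃) :
    (L.obstruction.2.2.2 (G.act a b₁) (G.β b₂) (G.β b₃)
      + E.action.ρ₁₀ (L.s₁ (G.β (G.β b₁))) (L.obstruction.2.2.1 a b₂ b₃)
      - L.obstruction.2.1 (G.bracket b₂ b₃) (G.α a) (G.β b₁)
      + (3 : k) • L.obstruction.2.1 (G.α a) (G.bracket b₂ b₃) (G.β b₁)) +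
    (L.obstruction.2.2.2 (G.act a b₂) (G.β b₃) (G.β b₁)
      + E.action.ρ₁₀ (L.s₁ (G.β (G.β b₂))) (L.obstruction.2.2.1 a b₃ b₁)
      - L.obstruction.2.1 (G.bracket b₃ b₁) (G.α a) (G.β b₂)
      + (3 : k) • L.obstruction.2.1 (G.α a) (G.bracket b₃ b₁) (G.β b₂)) +
    (L.obstruction.2.2.2 (G.act a b₃) (G.β b₁) (G.β b₂)
      + E.action.ρ₁₀ (L.s₁ (G.β (G.β b₃))) (L.obstruction.2.2.1 a b₁ b₂)
      - L.obstruction.2.1 (G.bracket b₁ b₂) (G.α a) (G.β b₃)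
      + (3 : k) • L.obstruction.2.1 (G.α a) (G.bracket b₁ b₂) (G.β b₃)) -
    (3 : k) • E.action.ρ₀₁ (L.s₀ (G.α (G.α a))) (L.obstruction.2.2.2 b₁ b₂ b₃) = 0 := by
  obtain ⟨symm, skew, wα₀, wα₁, wα₂⟩ := L.cochain
  simp only [obstruction₁_apply, obstruction₂_apply, obstruction₃_apply, map_add, map_sub,
    L.ρ₀₁_ρ₁₀, L.ρ₁₀_ρ₀₀, wα₂, G.β_act, G.α_bracket]
  -- Each `ω₁(a, bᵢ)` occurs under two odd operators in both orders, with opposite signs. Swapping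
  -- one of the two makes them cancel up to the bracket term.
  have e1 := L.ρ₁₀_ρ₁₁ (G.β b₃) (G.β b₂) (L.ω.2.1 a b₁)
  have e2 := L.ρ₁₀_ρ₁₁ (G.β b₁) (G.β b₃) (L.ω.2.1 a b₂)
  have e3 := L.ρ₁₀_ρ₁₁ (G.β b₂) (G.β b₁) (L.ω.2.1 a b₃)
  simp only [wα₁] at e1 e2 e3
  rw [e1, e2, e3]
  simp only [G.mul_comm (G.bracket _ _) (G.α a)]
  simp only [G.hom_deriv, map_add, LinearMap.add_apply]
  simp only [symm _ (G.α a), G.bracket_skew (G.β b₃) (G.act a b₁),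
    G.bracket_skew (G.β b₂) (G.act a b₃), G.bracket_skew (G.β b₁) (G.act a b₂),
    G.bracket_skew (G.β b₃) (G.β b₂), G.bracket_skew (G.β b₂) (G.β b₁),
    G.bracket_skew (G.β b₁) (G.β b₃), skew (G.β b₃) (G.β b₂), skew (G.β b₂) (G.β b₁),
    skew (G.β b₁) (G.β b₃), map_neg, LinearMap.neg_apply]
  -- The Jacobi identity of `𝔤` kills the terms `ω₁(α²a, [b₂, b₃] βb₁)` of `3 h₁`.
  have J := congrArg (L.ω.2.1 (G.α (G.α a))) (G.hom_jacobi b₁ b₂ b₃)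
  simp only [map_add, map_zero] at J
  clear e1 e2 e3
  linear_combination (norm := module) (3 : k) • J

/-! ### Descent of the obstruction to a cocycle with values in `M`. -/

theorem i_ρ₀₀ (a m) : E.i.even (ρ.ρ₀₀ a m) = E.action.ρ₀₀ (L.s₀ a) (E.i.even m) := by
  rw [E.induced_ρ₀₀, L.p_s₀]

theorem i_ρ₀₁ (a n) : E.i.odd (ρ.ρ₀₁ a n) = E.action.ρ₀₁ (L.s₀ a) (E.i.odd n) := by
  rw [E.induced_ρ₀₁, L.p_s₀]

theorem i_ρ₁₀ (b m) : E.i.odd (ρ.ρ₁₀ b m) = E.action.ρ₁₀ (L.s₁ b) (E.i.even m) := by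
  rw [E.induced_ρ₁₀, L.p_s₁]

theorem i_ρ₁₁ (b n) : E.i.even (ρ.ρ₁₁ b n) = E.action.ρ₁₁ (L.s₁ b) (E.i.odd n) := by
  rw [E.induced_ρ₁₁, L.p_s₁]

/-- The obstruction takes its values in `M`, where it is given by the quadruple `h`. -/
structure Represents (h : TrilinearQuadruple G M) : Prop where
  eq₀ : ∀ a₁ a₂ a₃, E.i.even (h.1 a₁ a₂ a₃) = L.obstruction.1 a₁ a₂ a₃
  eq₁ : ∀ a₁ a₂ b, E.i.odd (h.2.1 a₁ a₂ b) = L.obstruction.2.1 a₁ a₂ b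
  eq₂ : ∀ a b₁ b₂, E.i.even (h.2.2.1 a b₁ b₂) = L.obstruction.2.2.1 a b₁ b₂
  eq₃ : ∀ b₁ b₂ b₃, E.i.odd (h.2.2.2 b₁ b₂ b₃) = L.obstruction.2.2.2 b₁ b₂ b₃

/-- Over a field `i` has a linear left inverse. It need not commute with `α`: it is only used on the
kernel of `d`, which is the image of `i`, and equivariance is later checked after applying `i`. -/
theorem exists_retraction_even (E : CrossedModuleExtension.{v, u₁, u₂, w} ρ) :
    ∃ r : E.V.Even →ₗ[k] M.Even, ∀ u, E.d.even u = 0 → E.i.even (r u) = u := by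
  obtain ⟨r, hr⟩ :=
    LinearMap.exists_leftInverse_of_injective E.i.even (LinearMap.ker_eq_bot.2 E.i_even_injective)
  refine ⟨r, fun u hu => ?_⟩
  obtain ⟨m, rfl⟩ := (E.exact_V_even u).1 hu
  exact congrArg E.i.even (LinearMap.congr_fun hr m)

theorem exists_retraction_odd (E : CrossedModuleExtension.{v, u₁, u₂, w} ρ) :
    ∃ r : E.V.Odd →ₗ[k] M.Odd, ∀ v, E.d.odd v = 0 → E.i.odd (r v) = v := by
  obtain ⟨r, hr⟩ :=
    LinearMap.exists_leftInverse_of_injective E.i.odd (LinearMap.ker_eq_bot.2 E.i_odd_injective)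
  refine ⟨r, fun u hu => ?_⟩
  obtain ⟨m, rfl⟩ := (E.exact_V_odd u).1 hu
  exact congrArg E.i.odd (LinearMap.congr_fun hr m)

theorem exists_represents : ∃ h : TrilinearQuadruple G M, L.Represents h := by
  obtain ⟨r₀, hr₀⟩ := exists_retraction_even E
  obtain ⟨r₁, hr₁⟩ := exists_retraction_odd E
  refine ⟨(.mk₃ (fun a₁ a₂ a₃ => r₀ (L.obstruction.1 a₁ a₂ a₃)) ?_ ?_ ?_ ?_ ?_ ?_,
    .mk₃ (fun a₁ a₂ b => r₁ (L.obstruction.2.1 a₁ a₂ b)) ?_ ?_ ?_ ?_ ?_ ?_,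
    .mk₃ (fun a b₁ b₂ => r₀ (L.obstruction.2.2.1 a b₁ b₂)) ?_ ?_ ?_ ?_ ?_ ?_,
    .mk₃ (fun b₁ b₂ b₃ => r₁ (L.obstruction.2.2.2 b₁ b₂ b₃)) ?_ ?_ ?_ ?_ ?_ ?_), ?_⟩
  -- The first 24 goals are the linearity conditions, six for each of the four maps.
  on_goal 25 => exact
    ⟨fun _ _ _ => hr₀ _ (L.d_obstruction₀ _ _ _), fun _ _ _ => hr₁ _ (L.d_obstruction₁ _ _ _),
      fun _ _ _ => hr₀ _ (L.d_obstruction₂ _ _ _), fun _ _ _ => hr₁ _ (L.d_obstruction₃ _ _ _)⟩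
  all_goals
    intros
    simp only [map_add, map_smul, LinearMap.add_apply, LinearMap.smul_apply]

variable {L}

theorem Represents.isCochain₃ {h : TrilinearQuadruple G M} (H : L.Represents h) :
    IsCochain₃ h := by
  obtain ⟨e₀, e₁, e₂, e₃⟩ := H
  obtain ⟨p₁, p₂, p₃, p₄, p₅, p₆, p₇, p₈⟩ := L.obstruction_isCochain₃
  refine ⟨?_, ?_, ?_, ?_, ?_, ?_, ?_, ?_⟩
  · intro x y z
    apply E.i_even_injective
    simpa only [map_add, map_sub, map_zero, e₀] using p₁ x y z
  · intro x y z
    apply E.i_even_injective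
    simpa only [map_neg, e₂] using p₂ x y z
  · intro x y z
    apply E.i_odd_injective
    simpa only [map_neg, e₃] using p₃ x y z
  · intro x y z
    apply E.i_odd_injective
    simpa only [map_neg, e₃] using p₄ x y z
  · intro x y z
    apply E.i_even_injective
    exact (E.i.map_α _).trans (by simpa only [e₀] using p₅ x y z)
  · intro x y z
    apply E.i_odd_injective
    exact (E.i.map_β _).trans (by simpa only [e₁] using p₆ x y z)
  · intro x y z
    apply E.i_even_injective
    exact (E.i.map_α _).trans (by simpa only [e₂] using p₇ x y z)
  · intro x y z
    apply E.i_odd_injective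
    exact (E.i.map_β _).trans (by simpa only [e₃] using p₈ x y z)

/-- The injective map `i` intertwines the representation on `M` with the action at `s`, so the
identities in `V` pull back. -/
theorem Represents.isClosed₃ [CharZero k] {h : TrilinearQuadruple G M} (H : L.Represents h) :
    IsClosed₃ ρ h := by
  obtain ⟨e₀, e₁, e₂, e₃⟩ := H
  refine ⟨?_, ?_, ?_, ?_⟩
  · intro a₁ a₂ a₃ a₄
    apply E.i_even_injective
    simpa only [map_add, map_sub, map_zero, L.i_ρ₀₀, e₀] using L.obstruction_closed₀ a₁ a₂ a₃ a₄
  · intro a₁ a₂ a₃ b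
    apply E.i_odd_injective
    simpa only [map_add, map_sub, map_smul, map_zero, L.i_ρ₀₁, L.i_ρ₁₀, e₀, e₁] using
      L.obstruction_closed₁ a₁ a₂ a₃ b
  · intro a₁ a₂ b₁ b₂
    apply E.i_even_injective
    simpa only [map_add, map_sub, map_zero, L.i_ρ₀₀, L.i_ρ₁₁, e₀, e₁, e₂] using
      L.obstruction_closed₂ a₁ a₂ b₁ b₂
  · intro a b₁ b₂ b₃
    apply E.i_odd_injective
    simpa only [map_add, map_sub, map_smul, map_zero, L.i_ρ₀₁, L.i_ρ₁₀, e₁, e₂, e₃] using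
      L.obstruction_closed₃ a b₁ b₂ b₃

theorem exists_cocycle [CharZero k] (L : E.Lift) : ∃ c : cocycles₃ ρ, L.Represents c.1 :=
  let ⟨h, H⟩ := L.exists_represents
  ⟨⟨h, H.isCochain₃, H.isClosed₃⟩, H⟩

/-! ### Independence of the lift. -/

/-- Two lifts with the same section represent cohomologous cocycles. -/
theorem Represents.sub_mem_of_section_eq {L L' : E.Lift} (hs₀ : L.s₀ = L'.s₀) (hs₁ : L.s₁ = L'.s₁)
    {h h' : TrilinearQuadruple G M} (H : L.Represents h) (H' : L'.Represents h') :
    h - h' ∈ coboundaries₃ ρ := by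
  obtain ⟨r₀, hr₀⟩ := exists_retraction_even E
  obtain ⟨r₁, hr₁⟩ := exists_retraction_odd E
  have k₀ (a₁ a₂) : E.i.even (r₀ (L.ω.1 a₁ a₂ - L'.ω.1 a₁ a₂)) = L.ω.1 a₁ a₂ - L'.ω.1 a₁ a₂ :=
    hr₀ _ (by rw [map_sub, L.d_ω₀, L'.d_ω₀, hs₀, sub_self])
  have k₁ (a b) : E.i.odd (r₁ (L.ω.2.1 a b - L'.ω.2.1 a b)) = L.ω.2.1 a b - L'.ω.2.1 a b :=
    hr₁ _ (by rw [map_sub, L.d_ω₁, L'.d_ω₁, hs₀, hs₁, sub_self])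
  have k₂ (b₁ b₂) :
      E.i.even (r₀ (L.ω.2.2 b₁ b₂ - L'.ω.2.2 b₁ b₂)) = L.ω.2.2 b₁ b₂ - L'.ω.2.2 b₁ b₂ :=
    hr₀ _ (by rw [map_sub, L.d_ω₂, L'.d_ω₂, hs₀, hs₁, sub_self])
  -- Both cochains lift the same error, so their difference lies in the kernel of `d`. For fixed `s`
  -- the obstruction is linear in `ω`, hence `η` bounds `h - h'`.
  obtain ⟨η, hη₀, hη₁, hη₂⟩ : ∃ η : BilinearTriple G M,
      (∀ a₁ a₂, E.i.even (η.1 a₁ a₂) = L.ω.1 a₁ a₂ - L'.ω.1 a₁ a₂) ∧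
      (∀ a b, E.i.odd (η.2.1 a b) = L.ω.2.1 a b - L'.ω.2.1 a b) ∧
      (∀ b₁ b₂, E.i.even (η.2.2 b₁ b₂) = L.ω.2.2 b₁ b₂ - L'.ω.2.2 b₁ b₂) :=
    ⟨((L.ω.1 - L'.ω.1).compr₂ r₀, (L.ω.2.1 - L'.ω.2.1).compr₂ r₁,
      (L.ω.2.2 - L'.ω.2.2).compr₂ r₀), k₀, k₁, k₂⟩
  obtain ⟨p₁, p₂, p₃, p₄, p₅⟩ := L.cochain
  obtain ⟨q₁, q₂, q₃, q₄, q₅⟩ := L'.cochain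
  refine ⟨η, ⟨?_, ?_, ?_, ?_, ?_⟩, ?_, ?_, ?_, ?_⟩
  · intro x y
    apply E.i_even_injective
    rw [hη₀, hη₀, p₁, q₁]
  · intro x y
    apply E.i_even_injective
    rw [map_neg, hη₂, hη₂, p₂, q₂]
    abel
  · intro x y
    apply E.i_even_injective
    refine (E.i.map_α _).trans ?_
    rw [hη₀, hη₀, map_sub, p₃, q₃]
  · intro x y
    apply E.i_odd_injective
    refine (E.i.map_β _).trans ?_
    rw [hη₁, hη₁, map_sub, p₄, q₄]
  · intro x y
    apply E.i_even_injective
    refine (E.i.map_α _).trans ?_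
    rw [hη₂, hη₂, map_sub, p₅, q₅]
  · intro a₁ a₂ a₃
    apply E.i_even_injective
    simp only [Prod.fst_sub, LinearMap.sub_apply, map_add, map_sub, H.eq₀, H'.eq₀,
      L.i_ρ₀₀, hη₀, obstruction₀_apply, hs₀]
    abel
  · intro a₁ a₂ b
    apply E.i_odd_injective
    simp only [Prod.fst_sub, Prod.snd_sub, LinearMap.sub_apply, map_add, map_sub, map_smul, H.eq₁,
      H'.eq₁, L.i_ρ₀₁, L.i_ρ₁₀, hη₀, hη₁, obstruction₁_apply, hs₀, hs₁]
    module
  · intro a b₁ b₂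
    apply E.i_even_injective
    simp only [Prod.fst_sub, Prod.snd_sub, LinearMap.sub_apply, map_add, map_sub, H.eq₂, H'.eq₂,
      L.i_ρ₀₀, L.i_ρ₁₁, hη₀, hη₁, hη₂, obstruction₂_apply, hs₀, hs₁]
    abel
  · intro b₁ b₂ b₃
    apply E.i_odd_injective
    simp only [Prod.snd_sub, LinearMap.sub_apply, map_add, map_sub, H.eq₃, H'.eq₃,
      L.i_ρ₁₀, hη₁, hη₂, obstruction₃_apply, hs₁]
    abel

/-- The lift with the section `s + d ∘ F`, where `F : G → V` commutes with the structure maps. -/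
def translate (L : E.Lift) (F₀ : G.Even →ₗ[k] E.V.Even) (F₁ : G.Odd →ₗ[k] E.V.Odd)
    (hF₀ : ∀ a, F₀ (G.α a) = E.V.α (F₀ a)) (hF₁ : ∀ b, F₁ (G.β b) = E.V.β (F₁ b)) : E.Lift where
  s₀ := L.s₀ + E.d.even ∘ₗ F₀
  s₁ := L.s₁ + E.d.odd ∘ₗ F₁
  -- Expand the products of `s + dF` and pull every term but those in `s` back through `d`, by
  -- equivariance of `d`; the last term compensates for `dF` in the new section at a product.
  ω := (LinearMap.mk₂ k (fun a₁ a₂ => L.ω.1 a₁ a₂ + E.action.ρ₀₀ (L.s₀ a₁) (F₀ a₂)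
        + E.action.ρ₀₀ (L.s₀ a₂) (F₀ a₁) + E.V.mul (F₀ a₁) (F₀ a₂) - F₀ (G.mul a₁ a₂))
      (by intros; simp; abel) (by intros; simp; module)
      (by intros; simp; abel) (by intros; simp; module),
    LinearMap.mk₂ k (fun a b => L.ω.2.1 a b + E.action.ρ₀₁ (L.s₀ a) (F₁ b)
        + E.action.ρ₁₀ (L.s₁ b) (F₀ a) + E.V.act (F₀ a) (F₁ b) - F₁ (G.act a b))
      (by intros; simp; abel) (by intros; simp; module)
      (by intros; simp; abel) (by intros; simp; module),
    LinearMap.mk₂ k (fun b₁ b₂ => L.ω.2.2 b₁ b₂ + E.action.ρ₁₁ (L.s₁ b₁) (F₁ b₂)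
        - E.action.ρ₁₁ (L.s₁ b₂) (F₁ b₁) + E.V.bracket (F₁ b₁) (F₁ b₂) - F₀ (G.bracket b₁ b₂))
      (by intros; simp; abel) (by intros; simp; module)
      (by intros; simp; abel) (by intros; simp; module))
  p_s₀ a := by
    have := (E.exact_A_even _).2 ⟨F₀ a, rfl⟩
    simp [L.p_s₀, this]
  p_s₁ b := by
    have := (E.exact_A_odd _).2 ⟨F₁ b, rfl⟩
    simp [L.p_s₁, this]
  s₀_α a := by simp [L.s₀_α, hF₀, E.d.map_α]
  s₁_β b := by simp [L.s₁_β, hF₁, E.d.map_β]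
  cochain := by
    obtain ⟨symm, skew, wα₀, wα₁, wα₂⟩ := L.cochain
    refine ⟨?_, ?_, ?_, ?_, ?_⟩
    · intro x y
      simp only [LinearMap.mk₂_apply, symm x y, E.V.mul_comm (F₀ x), G.mul_comm x]
      abel
    · intro x y
      simp only [LinearMap.mk₂_apply, skew x y, E.V.bracket_skew (F₁ x), G.bracket_skew x, map_neg]
      abel
    · intro x y
      simp only [LinearMap.mk₂_apply, map_add, map_sub, E.action.α_ρ₀₀, E.V.α_mul, wα₀, L.s₀_α,
        ← hF₀, G.α_mul]
    · intro x y
      simp only [LinearMap.mk₂_apply, map_add, map_sub, E.action.β_ρ₀₁, E.action.β_ρ₁₀, E.V.β_act,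
        wα₁, L.s₀_α, L.s₁_β, ← hF₀, ← hF₁, G.β_act]
    · intro x y
      simp only [LinearMap.mk₂_apply, map_add, map_sub, E.action.α_ρ₁₁, E.V.α_bracket,
        wα₂, L.s₁_β, ← hF₀, ← hF₁, G.α_bracket]
  mul_s a₁ a₂ := by
    simp only [LinearMap.add_apply, LinearMap.comp_apply, LinearMap.mk₂_apply, map_add, map_sub,
      L.d_ω₀, E.crossed.d_ρ₀₀, E.d.map_mul, E.A.mul_comm (E.d.even (F₀ a₁)) (L.s₀ a₂)]
    abel
  act_s a b := by
    simp only [LinearMap.add_apply, LinearMap.comp_apply, LinearMap.mk₂_apply, map_add, map_sub,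
      L.d_ω₁, E.crossed.d_ρ₀₁, E.crossed.d_ρ₁₀, E.d.map_act]
    abel
  bracket_s b₁ b₂ := by
    simp only [LinearMap.add_apply, LinearMap.comp_apply, LinearMap.mk₂_apply, map_add, map_sub,
      L.d_ω₂, E.crossed.d_ρ₁₁, E.d.map_bracket, E.A.bracket_skew (E.d.odd (F₁ b₁)) (L.s₁ b₂)]
    abel

section Translate

variable (F₀ : G.Even →ₗ[k] E.V.Even) (F₁ : G.Odd →ₗ[k] E.V.Odd)
  (hF₀ : ∀ a, F₀ (G.α a) = E.V.α (F₀ a)) (hF₁ : ∀ b, F₁ (G.β b) = E.V.β (F₁ b))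

theorem translate_s₀ (a) : (L.translate F₀ F₁ hF₀ hF₁).s₀ a = L.s₀ a + E.d.even (F₀ a) := rfl

theorem translate_s₁ (b) : (L.translate F₀ F₁ hF₀ hF₁).s₁ b = L.s₁ b + E.d.odd (F₁ b) := rfl

theorem translate_ω₀ (a₁ a₂) : (L.translate F₀ F₁ hF₀ hF₁).ω.1 a₁ a₂ =
    L.ω.1 a₁ a₂ + E.action.ρ₀₀ (L.s₀ a₁) (F₀ a₂) + E.action.ρ₀₀ (L.s₀ a₂) (F₀ a₁)
      + E.V.mul (F₀ a₁) (F₀ a₂) - F₀ (G.mul a₁ a₂) := rfl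

theorem translate_ω₁ (a b) : (L.translate F₀ F₁ hF₀ hF₁).ω.2.1 a b =
    L.ω.2.1 a b + E.action.ρ₀₁ (L.s₀ a) (F₁ b) + E.action.ρ₁₀ (L.s₁ b) (F₀ a)
      + E.V.act (F₀ a) (F₁ b) - F₁ (G.act a b) := rfl

theorem translate_ω₂ (b₁ b₂) : (L.translate F₀ F₁ hF₀ hF₁).ω.2.2 b₁ b₂ =
    L.ω.2.2 b₁ b₂ + E.action.ρ₁₁ (L.s₁ b₁) (F₁ b₂) - E.action.ρ₁₁ (L.s₁ b₂) (F₁ b₁)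
      + E.V.bracket (F₁ b₁) (F₁ b₂) - F₀ (G.bracket b₁ b₂) := rfl

theorem mul_ρ₀₀ (a u₁ u₂) : E.V.mul (E.V.α u₁) (E.action.ρ₀₀ (L.s₀ a) u₂) =
    E.action.ρ₀₀ (L.s₀ (G.α a)) (E.V.mul u₁ u₂) := by
  rw [L.s₀_α, E.V.mul_comm u₁, E.action.even_mul, E.V.mul_comm]

/-- Sorted by degree in `F`: the linear terms cancel by the relations along `s`, whose corrections
`ω · F` meet the action of `dF` on `ω`; the quadratic ones by the compatibility of the action with
the product of `V`; the cubic ones by the identity of `V` itself. The same holds in the other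
components. -/
theorem translate_obstruction₀ (a₁ a₂ a₃) :
    (L.translate F₀ F₁ hF₀ hF₁).obstruction.1 a₁ a₂ a₃ = L.obstruction.1 a₁ a₂ a₃ := by
  simp only [obstruction₀_apply, translate_s₀, translate_ω₀, map_add, map_sub,
    LinearMap.add_apply, E.crossed.peiffer_mul, L.ρ₀₀_ρ₀₀, hF₀, L.mul_ρ₀₀, G.hom_assoc,
    E.V.hom_assoc]
  simp only [E.V.mul_comm _ (E.V.α (F₀ a₃)), E.V.mul_comm _ (E.V.α (F₀ a₁)),
    E.V.hom_assoc, G.mul_comm a₃, E.V.mul_comm (F₀ a₃), L.cochain.symm₀ a₃]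
  abel

theorem translate_obstruction₁ [CharZero k] (a₁ a₂ b) :
    (L.translate F₀ F₁ hF₀ hF₁).obstruction.2.1 a₁ a₂ b = L.obstruction.2.1 a₁ a₂ b := by
  have r₁ (x u v) : E.action.ρ₀₁ (L.s₀ (G.α x)) (E.V.act u v) =
      (2⁻¹ : k) • E.V.act (E.action.ρ₀₀ (L.s₀ x) u) (E.V.β v) := by
    rw [L.s₀_α, E.action.even_act]
  have r₂ (y u u') : E.V.act (E.V.α u) (E.action.ρ₁₀ (L.s₁ y) u') =
      (2⁻¹ : k) • E.action.ρ₁₀ (L.s₁ (G.β y)) (E.V.mul u u') := by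
    rw [L.s₁_β, E.action.odd_mul]
  simp only [obstruction₁_apply, translate_s₀, translate_s₁, translate_ω₀, translate_ω₁, map_add,
    map_sub, LinearMap.add_apply, E.crossed.peiffer_act,
    E.crossed.peiffer_act', L.ρ₀₁_ρ₀₁, L.ρ₀₁_ρ₁₀, L.ρ₁₀_ρ₀₀, hF₀, hF₁, r₁, r₂, G.hom_act,
    E.V.hom_act, E.action.even_act', map_smul]
  match_scalars <;> norm_num

theorem translate_obstruction₂ (a b₁ b₂) :
    (L.translate F₀ F₁ hF₀ hF₁).obstruction.2.2.1 a b₁ b₂ = L.obstruction.2.2.1 a b₁ b₂ := by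
  have r₁ (x v v') : E.action.ρ₀₀ (L.s₀ (G.α x)) (E.V.bracket v v') =
      E.V.bracket (E.action.ρ₀₁ (L.s₀ x) v) (E.V.β v') +
        E.V.bracket (E.V.β v) (E.action.ρ₀₁ (L.s₀ x) v') := by
    rw [L.s₀_α, E.action.even_bracket]
  have r₂ (y u v) : E.action.ρ₁₁ (L.s₁ (G.β y)) (E.V.act u v) =
      E.V.mul (E.V.α u) (E.action.ρ₁₁ (L.s₁ y) v) -
        E.V.bracket (E.action.ρ₁₀ (L.s₁ y) u) (E.V.β v) := by
    rw [L.s₁_β, E.action.odd_act]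
  -- The swap `ρ₁₁_ρ₁₀` is fixed at `b₂ b₁`: with free arguments it would apply to its own result.
  simp only [obstruction₂_apply, translate_s₀, translate_s₁, translate_ω₀, translate_ω₁,
    translate_ω₂, map_add, map_sub, LinearMap.add_apply,
    E.crossed.peiffer_mul, E.crossed.peiffer_bracket, L.ρ₀₀_ρ₁₁, L.ρ₁₁_ρ₁₀ b₂ b₁, hF₀, hF₁, r₁, r₂,
    G.hom_deriv, E.V.hom_deriv]
  simp only [E.V.bracket_skew (E.V.β _), G.bracket_skew b₂ b₁, L.cochain.skew₂ b₂ b₁,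
    E.V.mul_comm _ (E.V.α (F₀ a)), map_neg, LinearMap.neg_apply]
  abel

theorem translate_obstruction₃ (b₁ b₂ b₃) :
    (L.translate F₀ F₁ hF₀ hF₁).obstruction.2.2.2 b₁ b₂ b₃ = L.obstruction.2.2.2 b₁ b₂ b₃ := by
  have r (y v v') : E.action.ρ₁₀ (L.s₁ (G.β y)) (E.V.bracket v v') =
      E.V.act (E.action.ρ₁₁ (L.s₁ y) v') (E.V.β v) -
        E.V.act (E.action.ρ₁₁ (L.s₁ y) v) (E.V.β v') := by
    rw [L.s₁_β, E.action.odd_bracket]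
  have hV := E.V.hom_jacobi (F₁ b₁) (F₁ b₂) (F₁ b₃)
  have hG := congrArg F₁ (G.hom_jacobi b₁ b₂ b₃)
  simp only [map_add, map_zero] at hG
  simp only [obstruction₃_apply, translate_s₁, translate_ω₁,
    translate_ω₂, map_add, map_sub, LinearMap.add_apply,
    E.crossed.peiffer_act', L.ρ₁₀_ρ₁₁ b₁ b₂, L.ρ₁₀_ρ₁₁ b₂ b₃, L.ρ₁₀_ρ₁₁ b₃ b₁, hF₁, r]
  -- `hV` removes the terms cubic in `F`, `hG` the terms `F₁` of `[b₂, b₃] βb₁` and its cyclic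
  -- images.
  linear_combination (norm := abel) hV - hG

end Translate

theorem Represents.translate [CharZero k] {L : E.Lift} {h : TrilinearQuadruple G M}
    (H : L.Represents h) (F₀ : G.Even →ₗ[k] E.V.Even) (F₁ : G.Odd →ₗ[k] E.V.Odd)
    (hF₀ : ∀ a, F₀ (G.α a) = E.V.α (F₀ a)) (hF₁ : ∀ b, F₁ (G.β b) = E.V.β (F₁ b)) :
    (L.translate F₀ F₁ hF₀ hF₁).Represents h where
  eq₀ a₁ a₂ a₃ := by rw [translate_obstruction₀, H.eq₀]
  eq₁ a₁ a₂ b := by rw [translate_obstruction₁, H.eq₁]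
  eq₂ a b₁ b₂ := by rw [translate_obstruction₂, H.eq₂]
  eq₃ b₁ b₂ b₃ := by rw [translate_obstruction₃, H.eq₃]

/-- Any two lifts in a split extension represent cohomologous cocycles. -/
theorem Represents.sub_mem [CharZero k] (S : E.Sections) {L L' : E.Lift}
    {h h' : TrilinearQuadruple G M} (H : L.Represents h) (H' : L'.Represents h') :
    h - h' ∈ coboundaries₃ ρ := by
  -- The sections differ by a map into the kernel of `p`; composing it with `σ` gives the
  -- equivariant `F` with `dF = s' - s`. Only here does the comparison of lifts use the splitting of
  -- the extension.
  let n₀ : G.Even →ₗ[k] LinearMap.ker E.p.even := (L'.s₀ - L.s₀).codRestrict _ fun a => by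
    simp [L.p_s₀, L'.p_s₀]
  let n₁ : G.Odd →ₗ[k] LinearMap.ker E.p.odd := (L'.s₁ - L.s₁).codRestrict _ fun b => by
    simp [L.p_s₁, L'.p_s₁]
  have hF₀ (a) : (S.σ₀ ∘ₗ n₀) (G.α a) = E.V.α ((S.σ₀ ∘ₗ n₀) a) :=
    S.σ₀_α _ _ (by simp [n₀, L.s₀_α, L'.s₀_α])
  have hF₁ (b) : (S.σ₁ ∘ₗ n₁) (G.β b) = E.V.β ((S.σ₁ ∘ₗ n₁) b) :=
    S.σ₁_β _ _ (by simp [n₁, L.s₁_β, L'.s₁_β])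
  -- The translated lift has the section of `L'` and still represents `h`.
  refine (H.translate _ _ hF₀ hF₁).sub_mem_of_section_eq ?_ ?_ H'
  · ext a
    simp [translate_s₀, S.d_σ₀, n₀]
  · ext b
    simp [translate_s₁, S.d_σ₁, n₁]

end Lift

/-! ### Sections, morphisms and the class of an extension. -/

/-- The lift given by sections of a crossed module extension. -/
def Sections.toLift {E : CrossedModuleExtension.{v, u₁, u₂, w} ρ} (S : E.Sections) : E.Lift where
  s₀ := S.s₀
  s₁ := S.s₁
  ω := ((LinearMap.mk₂ k (fun a₁ a₂ => (⟨E.A.mul (S.s₀ a₁) (S.s₀ a₂) - S.s₀ (G.mul a₁ a₂), by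
        simp [E.p.map_mul, S.p_s₀]⟩ : LinearMap.ker E.p.even))
      (by intros; ext; simp; abel) (by intros; ext; simp; module)
      (by intros; ext; simp; abel) (by intros; ext; simp; module)).compr₂ S.σ₀,
    (LinearMap.mk₂ k (fun a b => (⟨E.A.act (S.s₀ a) (S.s₁ b) - S.s₁ (G.act a b), by
        simp [E.p.map_act, S.p_s₀, S.p_s₁]⟩ : LinearMap.ker E.p.odd))
      (by intros; ext; simp; abel) (by intros; ext; simp; module)
      (by intros; ext; simp; abel) (by intros; ext; simp; module)).compr₂ S.σ₁,
    (LinearMap.mk₂ k (fun b₁ b₂ => (⟨E.A.bracket (S.s₁ b₁) (S.s₁ b₂) - S.s₀ (G.bracket b₁ b₂), by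
        simp [E.p.map_bracket, S.p_s₁, S.p_s₀]⟩ : LinearMap.ker E.p.even))
      (by intros; ext; simp; abel) (by intros; ext; simp; module)
      (by intros; ext; simp; abel) (by intros; ext; simp; module)).compr₂ S.σ₀)
  p_s₀ := S.p_s₀
  p_s₁ := S.p_s₁
  s₀_α := S.s₀_α
  s₁_β := S.s₁_β
  cochain := by
    refine ⟨fun x y => ?_, fun x y => ?_, fun x y => ?_, fun x y => ?_, fun x y => ?_⟩
    · simp only [LinearMap.compr₂_apply, LinearMap.mk₂_apply]
      congr 2
      rw [E.A.mul_comm, G.mul_comm]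
    · simp only [LinearMap.compr₂_apply, LinearMap.mk₂_apply]
      rw [← map_neg]
      congr 1
      ext
      simp only [E.A.bracket_skew (S.s₁ x), G.bracket_skew x, map_neg, Submodule.coe_neg]
      abel
    · refine (S.σ₀_α _ _ ?_).symm
      simp [E.A.α_mul, S.s₀_α, ← G.α_mul]
    · refine (S.σ₁_β _ _ ?_).symm
      simp [E.A.β_act, S.s₀_α, S.s₁_β, ← G.β_act]
    · refine (S.σ₀_α _ _ ?_).symm
      simp [E.A.α_bracket, S.s₀_α, S.s₁_β, ← G.α_bracket]
  mul_s a₁ a₂ := by simp [S.d_σ₀]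
  act_s a b := by simp [S.d_σ₁]
  bracket_s b₁ b₂ := by simp [S.d_σ₀]

/-- The formulas for `h` in terms of `σ` and the obstruction of the lift agree by unfolding. -/
theorem Sections.represents_iff {E : CrossedModuleExtension.{v, u₁, u₂, w} ρ} (S : E.Sections)
    (h : TrilinearQuadruple G M) : S.Represents h ↔ S.toLift.Represents h :=
  ⟨fun ⟨e₀, e₁, e₂, e₃⟩ => ⟨e₀, e₁, e₂, e₃⟩, fun ⟨e₀, e₁, e₂, e₃⟩ => ⟨e₀, e₁, e₂, e₃⟩⟩

section Morphism

variable {E E' : CrossedModuleExtension.{v, u₁, u₂, w} ρ} (f : E.Morphism E')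

/-- The image of a lift under a morphism of crossed module extensions. -/
def Lift.map (L : E.Lift) : E'.Lift where
  s₀ := f.ψ.even ∘ₗ L.s₀
  s₁ := f.ψ.odd ∘ₗ L.s₁
  ω := (L.ω.1.compr₂ f.φ.even, L.ω.2.1.compr₂ f.φ.odd, L.ω.2.2.compr₂ f.φ.even)
  p_s₀ a := (f.p_ψ_even _).trans (L.p_s₀ a)
  p_s₁ b := (f.p_ψ_odd _).trans (L.p_s₁ b)
  s₀_α a := by simp [L.s₀_α, f.ψ.map_α]
  s₁_β b := by simp [L.s₁_β, f.ψ.map_β]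
  cochain := by
    obtain ⟨symm, skew, wα₀, wα₁, wα₂⟩ := L.cochain
    refine ⟨fun x y => ?_, fun x y => ?_, fun x y => ?_, fun x y => ?_, fun x y => ?_⟩
    · simp [symm x y]
    · simp [skew x y]
    · simp [← f.φ.map_α, wα₀]
    · simp [← f.φ.map_β, wα₁]
    · simp [← f.φ.map_α, wα₂]
  mul_s a₁ a₂ := by simp [← f.ψ.map_mul, L.mul_s, f.d_φ_even]
  act_s a b := by simp [← f.ψ.map_act, L.act_s, f.d_φ_odd]
  bracket_s b₁ b₂ := by simp [← f.ψ.map_bracket, L.bracket_s, f.d_φ_even]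

/-- The map `φ` respects the actions, so it carries one obstruction to the other; since `φ ∘ i =
i'`, the quadruple in `M` is the same. -/
theorem Lift.Represents.map {L : E.Lift} {h : TrilinearQuadruple G M} (H : L.Represents h) :
    (L.map f).Represents h where
  eq₀ a₁ a₂ a₃ := by
    rw [← f.φ_i_even, H.eq₀]
    simp [obstruction₀_apply, Lift.map, f.φ_ρ₀₀]
  eq₁ a₁ a₂ b := by
    rw [← f.φ_i_odd, H.eq₁]
    simp [obstruction₁_apply, Lift.map, f.φ_ρ₀₁, f.φ_ρ₁₀]
  eq₂ a b₁ b₂ := by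
    rw [← f.φ_i_even, H.eq₂]
    simp [obstruction₂_apply, Lift.map, f.φ_ρ₀₀, f.φ_ρ₁₁]
  eq₃ b₁ b₂ b₃ := by
    rw [← f.φ_i_odd, H.eq₃]
    simp [obstruction₃_apply, Lift.map, f.φ_ρ₁₀]

end Morphism

theorem Sections.exists_cocycle [CharZero k] {E : CrossedModuleExtension.{v, u₁, u₂, w} ρ}
    (S : E.Sections) : ∃ c : cocycles₃ ρ, S.Represents c.1 :=
  let ⟨c, hc⟩ := S.toLift.exists_cocycle
  ⟨c, (S.represents_iff c.1).2 hc⟩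

/-- The class of the cocycle given by sections is preserved by morphisms of extensions. -/
theorem Morphism.mk_eq_mk [CharZero k] {E E' : CrossedModuleExtension.{v, u₁, u₂, w} ρ}
    (f : E.Morphism E') {S : E.Sections} {S' : E'.Sections} {c c' : cocycles₃ ρ}
    (hc : S.Represents c.1) (hc' : S'.Represents c'.1) :
    (Submodule.Quotient.mk c : H₃ ρ) = Submodule.Quotient.mk c' :=
  (Submodule.Quotient.eq _).2 <|
    -- Both lifts now live in `E'`, where the sections `S'` supply the splitting needed to compare
    -- them.
    (((S.represents_iff _).1 hc).map f).sub_mem S' ((S'.represents_iff _).1 hc')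

/-- The class of the cocycle given by sections does not depend on the sections. -/
theorem Sections.mk_eq_mk [CharZero k] {E : CrossedModuleExtension.{v, u₁, u₂, w} ρ}
    {S S' : E.Sections} {c c' : cocycles₃ ρ} (hc : S.Represents c.1) (hc' : S'.Represents c'.1) :
    (Submodule.Quotient.mk c : H₃ ρ) = Submodule.Quotient.mk c' :=
  (Submodule.Quotient.eq _).2 <|
    ((S.represents_iff _).1 hc).sub_mem S ((S'.represents_iff _).1 hc')

end CrossedModuleExtension

theorem theorem5p1 {k : Type v} [Field k] [IsAlgClosed k] [CharZero k]
    (G : HomLieAntialgebra.{v, u₁} k) (M : HomSuperSpace.{v, u₂} k) (ρ : HomLieRep G M) :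
    ∃! ξ : CExt.{v, u₁, u₂, w} ρ → H₃ ρ,
      ∀ (E : SplitExtension.{v, u₁, u₂, w} ρ) (S : E.1.Sections),
        ∃ c : cocycles₃ ρ, S.Represents c.1 ∧ ξ (CExt.mk E) = Submodule.Quotient.mk c := by
  -- A cocycle is fixed for each extension through an arbitrary choice of sections. A single
  -- morphism needs checking, since the quotient is by the relation it generates.
  choose c hc using fun E : SplitExtension.{v, u₁, u₂, w} ρ => E.2.some.exists_cocycle
  refine ⟨Quot.lift (fun E => Submodule.Quotient.mk (c E))
    fun E E' ⟨f⟩ => f.mk_eq_mk (hc E) (hc E'), fun E S => ?_, fun ξ hξ => ?_⟩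
  · obtain ⟨c', hc'⟩ := S.exists_cocycle
    exact ⟨c', hc', CrossedModuleExtension.Sections.mk_eq_mk (hc E) hc'⟩
  · funext x
    obtain ⟨E, rfl⟩ := Quot.exists_rep x
    -- An extension in the domain has sections, so the condition on `ξ` is never vacuous and fixes
    -- its value.
    obtain ⟨c', hc', h⟩ := hξ E E.2.some
    exact h.trans (CrossedModuleExtension.Sections.mk_eq_mk hc' (hc E))
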